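/- Let $n\ge 2$ be an integer. (1) For $z\in\mathbb{C}$ with $\Re z=-1$ let $$Uf(x)=\int_{-\infty}^{\infty}e^{i(x-y)^n}(1+|x-y|)^{z}f(y)\,dy .$$ There is a constant $C$ depending only on $n$ such that for all $z$ with $\Re z=-1$: for every $f\in L^2(\mathbb{R})$ the integral converges absolutely for every $x$ and $\|Uf\|_{L^2}\le C(1+|\Im z|)^2\|f\|_{L^2}$; and for every $f\in H^1(\mathbb{R})$ the integral converges absolutely for every $x$ and $\|Uf\|_{L^1}\le C(1+|\Im z|)^2\|f\|_{H^1}$. Here $H^1(\mathbb{R})$ is the atomic Hardy space: an atom is a measurable function $a:\mathbb{R}\to\mathbb{C}$ supported in a compact interval $Q$ of positive length with $|a|\le|Q|^{-1}$ a.e. and $\int a=0$; $H^1(\mathbb{R})$ consists of all $f\in L^1(\mathbb{R})$ of the form $f=\sum_j\mu_ja_j$ (convergence in $L^1$) with atoms $a_j$ and $\mu_j\in\mathbb{C}$, $\sum_j|\mu_j|<\infty$; and $\|f\|_{H^1}$ is the infimum of $\sum_j|\mu_j|$ over all such decompositions. (2) For $\varphi\in C_0^\infty(\mathbb{R}^2)$,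 $\lambda\in\mathbb{R}\setminus\{0\}$ and $\Re z=-1$ let $$W_\lambda f(x)=\int_{-\infty}^{\infty}e^{i\lambda(x-y)^n}\left(|\lambda|^{-1/n}+|x-y|\right)^{z}\varphi(x,y)f(y)\,dy .$$ There is a constant $C$ depending only on $n$ and $\varphi$ such that for all $\lambda\ne0$, all $z$ with $\Re z=-1$ and all $f\in L^2(\mathbb{R})$, the integral converges absolutely for every $x$ and $\|W_\lambda f\|_{L^2}\le C(1+|\Im z|)^2\|f\|_{L^2}$. -/

import Mathlib

open MeasureTheory Filter Topology
open scoped ENNReal ContDiff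

noncomputable section

/-- The kernel `e^{i(x-y)^n} (1+|x-y|)^z`. -/
def transInvKernel (n : ℕ) (z : ℂ) (x y : ℝ) : ℂ :=
  Complex.exp (Complex.I * (((x - y) ^ n : ℝ) : ℂ)) * ((1 + |x - y| : ℝ) : ℂ) ^ z

/-- The operator `U f(x) = ∫ e^{i(x-y)^n} (1+|x-y|)^z f(y) dy`. -/
def transInvOp (n : ℕ) (z : ℂ) (f : ℝ → ℂ) (x : ℝ) : ℂ :=
  ∫ y, transInvKernel n z x y * f y

/-- The kernel `e^{iλ(x-y)^n} (|λ|^{-1/n}+|x-y|)^z φ(x,y)`, with `l` standing for `λ`. -/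
def cutoffKernel (n : ℕ) (z : ℂ) (φ : ℝ × ℝ → ℂ) (l : ℝ) (x y : ℝ) : ℂ :=
  Complex.exp (Complex.I * ((l * (x - y) ^ n : ℝ) : ℂ)) *
    ((|l| ^ (-(1 / (n : ℝ))) + |x - y| : ℝ) : ℂ) ^ z * φ (x, y)

/-- The operator `W_λ f(x) = ∫ e^{iλ(x-y)^n} (|λ|^{-1/n}+|x-y|)^z φ(x,y) f(y) dy`. -/
def cutoffOp (n : ℕ) (z : ℂ) (φ : ℝ × ℝ → ℂ) (l : ℝ) (f : ℝ → ℂ) (x : ℝ) : ℂ :=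
  ∫ y, cutoffKernel n z φ l x y * f y

/-- An `L^∞` atom of the real Hardy space `H^1(ℝ)`: a measurable function supported in an
interval `Q = [c - r, c + r]` of length `|Q| = 2r > 0`, bounded by `|Q|⁻¹` almost everywhere,
with vanishing integral. -/
def IsH1Atom (a : ℝ → ℂ) : Prop :=
  Measurable a ∧ (∃ c r : ℝ, 0 < r ∧ Function.support a ⊆ Set.Icc (c - r) (c + r) ∧
    ∀ᵐ x, ‖a x‖ ≤ (2 * r)⁻¹) ∧ ∫ x, a x = 0

/-- `f = ∑ⱼ μⱼ aⱼ` with atoms `aⱼ` and `∑ⱼ |μⱼ| < ∞`, the series converging to `f` in `L^1`. -/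
def IsAtomicDecomposition (f : ℝ → ℂ) (μ : ℕ → ℂ) (a : ℕ → ℝ → ℂ) : Prop :=
  (∀ j, IsH1Atom (a j)) ∧ Summable (fun j => ‖μ j‖) ∧
    Tendsto (fun N : ℕ => eLpNorm (fun x => f x - ∑ j ∈ Finset.range N, μ j * a j x) 1 volume)
      atTop (𝓝 0)

/-- Membership in the (atomic) Hardy space `H^1(ℝ)`. -/
def MemH1 (f : ℝ → ℂ) : Prop :=
  MemLp f 1 volume ∧ ∃ μ a, IsAtomicDecomposition f μ a

/-- The atomic norm `‖f‖_{H^1} = inf ∑ⱼ |μⱼ|` over all atomic decompositions `f = ∑ⱼ μⱼ aⱼ`. -/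
def h1Norm (f : ℝ → ℂ) : ℝ≥0∞ :=
  ⨅ (μ : ℕ → ℂ) (a : ℕ → ℝ → ℂ) (_ : IsAtomicDecomposition f μ a), ∑' j, ‖μ j‖ₑ

end

/-!
Both operators are built from the convolution kernel `k(t) = e^{i l t^n} (δ + |t|)^z`
(`oscKernel`), with `l = δ = 1` for `U` and `|l| δ^n = 1` for `W_λ`.

*`L²` bounds.* Adding a linear term to the phase `l t^n` does not change its second derivative,
which is at least `|l| α^{n-2}` in absolute value for `|t| ≥ α`. Van der Corput's test
(`norm_integral_exp_mul_le`) therefore bounds the Fourier transform of the part `α ≤ |t| ≤ β` of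
the kernel by a multiple of `(1 + |Im z|) (|l| α^{n-2})^{-1/2} (δ + α)^{-1}`, uniformly in `β` and
the frequency (`norm_fourier_annulus_le`). At `α = δ` this is `O(1 + |Im z|)`, and the rest of the
kernel has `L¹` norm at most `2`; so the truncations of `k` are Fourier multipliers with a uniform
bound, and Plancherel's theorem and Fatou's lemma give the bound for `k` itself
(`eLpNorm_oscKernel_conv_le`).

*The Hardy space bound.* Let `a` be an atom on `[-r, r]`. On `|x| ≤ 4r` the `L²` bound and the
Cauchy–Schwarz inequality suffice. If `r < 1`, then up to `|x| ∼ R = r^{-1/(n-1)}` one uses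
`∫ a = 0` and `|k'(t)| ≤ n |t|^{n-2} + |z| / t²` (`setLIntegral_middle_le`). Beyond `R`, on an
annulus `|x| ∼ A` only the part `|t| ∼ A` of the kernel acts on `a`; convolution with that part has
`L²` operator norm `O(A^{-n/2})`, and Cauchy–Schwarz yields an `L¹` norm `O((A^{n-1} r)^{-1/2})`,
which is summable over `A = 4^j R` (`setLIntegral_far_le`). Summing over the atoms of a
decomposition gives the bound on `H¹`.

*The cutoff.* Writing `φ(x, y) = ∫ 1_{s < y} ∂₂φ(x, s) ds` over a bounded interval expresses `W_λ f`
as an average over `s` of bounded multiples of `k * (f 1_{(s, ∞)})`, so that the cutoff costs only a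
constant depending on `φ` (`eLpNorm_conv_amplitude_le`).

All bounds obtained are linear in `1 + |Im z|`, hence stronger than the quadratic ones claimed.
-/

/-! ### Van der Corput estimates -/

theorem norm_exp_I_mul_ofReal (x : ℝ) : ‖Complex.exp (Complex.I * (x : ℂ))‖ = 1 := by
  rw [mul_comm]; exact Complex.norm_exp_ofReal_mul_I x

/-- First derivative test for an oscillatory integral with convex phase `θ` (so that `θ'` is
monotone): integrate by parts against `1 / θ'`, whose total variation telescopes. -/
theorem norm_integral_exp_le_of_le_deriv {θ θ' θ'' : ℝ → ℝ} {a b ρ : ℝ} (hab : a ≤ b)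
    (h1 : ∀ t, HasDerivAt θ (θ' t) t) (h2 : ∀ t, HasDerivAt θ' (θ'' t) t)
    (hc : Continuous θ'') (hρ : 0 < ρ) (hle : ∀ t ∈ Set.Icc a b, ρ ≤ θ' t)
    (hconv : ∀ t ∈ Set.Icc a b, 0 ≤ θ'' t) :
    ‖∫ t in a..b, Complex.exp (Complex.I * (θ t : ℂ))‖ ≤ 2 / ρ := by
  have c0 : Continuous θ := continuous_iff_continuousAt.2 fun t => (h1 t).continuousAt
  have c1 : Continuous θ' := continuous_iff_continuousAt.2 fun t => (h2 t).continuousAt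
  have hpos : ∀ t ∈ Set.uIcc a b, 0 < θ' t := by
    intro t ht
    rw [Set.uIcc_of_le hab] at ht
    exact hρ.trans_le (hle t ht)
  set E : ℝ → ℂ := fun t => Complex.exp (Complex.I * (θ t : ℂ)) with hE
  have cE : Continuous E := by fun_prop
  have nE : ∀ t, ‖E t‖ = 1 := fun t => norm_exp_I_mul_ofReal _
  have dE : ∀ t, HasDerivAt E (E t * (Complex.I * (θ' t : ℂ))) t := fun t =>
    ((h1 t).ofReal_comp.const_mul Complex.I).cexp
  have dinv : ∀ t ∈ Set.uIcc a b, HasDerivAt (fun t => (θ' t)⁻¹) (-θ'' t / θ' t ^ 2) t :=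
    fun t ht => (h2 t).inv (hpos t ht).ne'
  have ci : ContinuousOn (fun t => -θ'' t / θ' t ^ 2) (Set.uIcc a b) :=
    (hc.neg.continuousOn).div ((c1.pow 2).continuousOn) fun t ht => by
      have := hpos t ht; positivity
  have dv : ∀ t ∈ Set.uIcc a b, HasDerivAt
      (fun t => E t * (-Complex.I * (((θ' t)⁻¹ : ℝ) : ℂ)))
      (E t + E t * (-Complex.I * ((-θ'' t / θ' t ^ 2 : ℝ) : ℂ))) t := by
    intro t ht
    refine ((dE t).mul ((dinv t ht).ofReal_comp.const_mul (-Complex.I))).congr_deriv ?_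
    have h0 : (θ' t : ℂ) ≠ 0 := by exact_mod_cast (hpos t ht).ne'
    push_cast
    field_simp
    linear_combination (-(E t * (θ' t : ℂ) ^ 2)) * Complex.I_sq
  have int1 : IntervalIntegrable E volume a b := cE.intervalIntegrable _ _
  have int2 : IntervalIntegrable
      (fun t => E t * (-Complex.I * ((-θ'' t / θ' t ^ 2 : ℝ) : ℂ))) volume a b := by
    apply ContinuousOn.intervalIntegrable
    exact cE.continuousOn.mul
      (continuousOn_const.mul (Complex.continuous_ofReal.comp_continuousOn ci))
  have key := intervalIntegral.integral_eq_sub_of_hasDerivAt dv (int1.add int2)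
  rw [intervalIntegral.integral_add int1 int2] at key
  have tele := intervalIntegral.integral_eq_sub_of_hasDerivAt dinv (ci.intervalIntegrable)
  have b2 : ‖∫ t in a..b, E t * (-Complex.I * ((-θ'' t / θ' t ^ 2 : ℝ) : ℂ))‖
      ≤ (θ' a)⁻¹ - (θ' b)⁻¹ := by
    calc _ ≤ ∫ t in a..b, -(-θ'' t / θ' t ^ 2) := by
          apply intervalIntegral.norm_integral_le_of_norm_le hab
          · refine ae_of_all _ fun t ht => ?_
            have ht' : t ∈ Set.Icc a b := Set.Ioc_subset_Icc_self ht
            rw [norm_mul, nE, norm_mul, norm_neg, Complex.norm_I, Complex.norm_real,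
              Real.norm_eq_abs, one_mul, one_mul, abs_of_nonpos]
            rw [neg_div]
            exact neg_nonpos.2 (div_nonneg (hconv t ht') (sq_nonneg _))
          · exact ci.intervalIntegrable.neg
      _ = _ := by rw [intervalIntegral.integral_neg, tele]; ring
  have ha : 0 < θ' a := hpos a Set.left_mem_uIcc
  have hb : 0 < θ' b := hpos b Set.right_mem_uIcc
  have nv : ∀ t, 0 < θ' t → ‖E t * (-Complex.I * (((θ' t)⁻¹ : ℝ) : ℂ))‖ = (θ' t)⁻¹ := by
    intro t ht
    rw [norm_mul, nE, norm_mul, norm_neg, Complex.norm_I, Complex.norm_real,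
              Real.norm_eq_abs, one_mul, one_mul, abs_of_pos (inv_pos.2 ht)]
  have : ∫ t in a..b, E t = E b * (-Complex.I * (((θ' b)⁻¹ : ℝ) : ℂ))
      - E a * (-Complex.I * (((θ' a)⁻¹ : ℝ) : ℂ))
      - ∫ t in a..b, E t * (-Complex.I * ((-θ'' t / θ' t ^ 2 : ℝ) : ℂ)) := by
    rw [← key]; ring
  rw [this]
  calc _ ≤ (θ' b)⁻¹ + (θ' a)⁻¹ + ((θ' a)⁻¹ - (θ' b)⁻¹) := by
        refine (norm_sub_le _ _).trans (add_le_add ((norm_sub_le _ _).trans ?_) b2)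
        rw [nv a ha, nv b hb]
    _ = 2 * (θ' a)⁻¹ := by ring
    _ ≤ 2 / ρ := by
        rw [div_eq_mul_inv]
        gcongr
        exact hle a (Set.left_mem_Icc.2 hab)

/-- Second derivative test on an interval on which the phase is increasing. The part of the
interval within `1 / √μ` of its left end is estimated trivially. -/
theorem norm_integral_exp_le_of_deriv_nonneg {θ θ' θ'' : ℝ → ℝ} {a b μ : ℝ} (hab : a ≤ b)
    (h1 : ∀ t, HasDerivAt θ (θ' t) t) (h2 : ∀ t, HasDerivAt θ' (θ'' t) t)
    (hc : Continuous θ'') (hμ : 0 < μ) (ha : 0 ≤ θ' a)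
    (hconv : ∀ t ∈ Set.Icc a b, μ ≤ θ'' t) :
    ‖∫ t in a..b, Complex.exp (Complex.I * (θ t : ℂ))‖ ≤ 3 / √μ := by
  have c0 : Continuous θ := continuous_iff_continuousAt.2 fun t => (h1 t).continuousAt
  have hs : 0 < √μ := Real.sqrt_pos.2 hμ
  have hs2 : √μ * √μ = μ := Real.mul_self_sqrt hμ.le
  have cE : Continuous fun t => Complex.exp (Complex.I * (θ t : ℂ)) := by fun_prop
  have triv : ∀ c d : ℝ, c ≤ d →
      ‖∫ t in c..d, Complex.exp (Complex.I * (θ t : ℂ))‖ ≤ d - c := by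
    intro c d hcd
    have := intervalIntegral.norm_integral_le_of_norm_le_const (a := c) (b := d)
      (f := fun t => Complex.exp (Complex.I * (θ t : ℂ))) (C := 1)
      (fun t _ => (norm_exp_I_mul_ofReal _).le)
    rwa [one_mul, abs_of_nonneg (sub_nonneg.2 hcd)] at this
  rcases le_total b (a + 1 / √μ) with hb | hb
  · refine (triv a b hab).trans ?_
    have : 1 / √μ ≤ 3 / √μ := by gcongr; norm_num
    linarith
  · have hh : 0 < 1 / √μ := by positivity
    have hlow : ∀ t ∈ Set.Icc (a + 1 / √μ) b, √μ ≤ θ' t := by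
      intro t ht
      have hat : a ≤ t := by linarith [ht.1]
      have hmv : μ * (t - a) ≤ θ' t - θ' a := by
        refine Convex.mul_sub_le_image_sub_of_le_deriv (convex_Icc a b)
          (fun s _ => (h2 s).continuousAt.continuousWithinAt)
          (fun s _ => (h2 s).differentiableAt.differentiableWithinAt) ?_ a ⟨le_rfl, hab⟩ t
          ⟨hat, ht.2⟩ hat
        intro s hs'
        rw [(h2 s).deriv]
        exact hconv s (interior_subset hs')
      have h3 : √μ ≤ μ * (t - a) := by
        have : μ * (1 / √μ) ≤ μ * (t - a) := by
          gcongr; linarith [ht.1]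
        refine le_trans (le_of_eq ?_) this
        rw [mul_one_div, eq_div_iff hs.ne', hs2]
      linarith
    rw [← intervalIntegral.integral_add_adjacent_intervals (b := a + 1 / √μ)
      (cE.intervalIntegrable _ _) (cE.intervalIntegrable _ _)]
    have e1 := triv a (a + 1 / √μ) (by linarith)
    have e2 := norm_integral_exp_le_of_le_deriv hb h1 h2 hc hs hlow
      (fun t ht => hμ.le.trans (hconv t ⟨by linarith [ht.1], ht.2⟩))
    calc _ ≤ _ := norm_add_le _ _
      _ ≤ 1 / √μ + 2 / √μ := by linarith
      _ = 3 / √μ := by ring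

/-- Van der Corput's second derivative test. A zero of the increasing function `θ'` splits the
interval into two on which `θ` is monotone. -/
theorem norm_integral_exp_le_of_le_deriv2 {θ θ' θ'' : ℝ → ℝ} {a b μ : ℝ} (hab : a ≤ b)
    (h1 : ∀ t, HasDerivAt θ (θ' t) t) (h2 : ∀ t, HasDerivAt θ' (θ'' t) t)
    (hc : Continuous θ'') (hμ : 0 < μ) (hconv : ∀ t ∈ Set.Icc a b, μ ≤ θ'' t) :
    ‖∫ t in a..b, Complex.exp (Complex.I * (θ t : ℂ))‖ ≤ 6 / √μ := by
  have c0 : Continuous θ := continuous_iff_continuousAt.2 fun t => (h1 t).continuousAt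
  have c1 : Continuous θ' := continuous_iff_continuousAt.2 fun t => (h2 t).continuousAt
  have cE : Continuous fun t => Complex.exp (Complex.I * (θ t : ℂ)) := by fun_prop
  have h36 : 3 / √μ ≤ 6 / √μ := by gcongr; norm_num
  -- the reflection `t ↦ -t` turns a decreasing phase into an increasing one
  have left : ∀ c ∈ Set.Icc a b, θ' c ≤ 0 →
      ‖∫ t in a..c, Complex.exp (Complex.I * (θ t : ℂ))‖ ≤ 3 / √μ := by
    intro c hcm hc0
    have := norm_integral_exp_le_of_deriv_nonneg (θ := fun t => θ (-t)) (θ' := fun t => -θ' (-t))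
      (θ'' := fun t => θ'' (-t)) (a := -c) (b := -a) (μ := μ) (by linarith [hcm.1])
      (fun t => by simpa [Function.comp_def] using (h1 (-t)).comp t (hasDerivAt_neg t))
      (fun t => by simpa [Function.comp_def] using! ((h2 (-t)).comp t (hasDerivAt_neg t)).neg)
      (by fun_prop) hμ (by simpa using hc0)
      (fun t ht => hconv (-t) ⟨by linarith [ht.2], by linarith [ht.1, hcm.2]⟩)
    rwa [intervalIntegral.integral_comp_neg
      (f := fun t => Complex.exp (Complex.I * (θ t : ℂ))), neg_neg, neg_neg] at this
  have right : ∀ c ∈ Set.Icc a b, 0 ≤ θ' c →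
      ‖∫ t in c..b, Complex.exp (Complex.I * (θ t : ℂ))‖ ≤ 3 / √μ := fun c hcm hc0 =>
    norm_integral_exp_le_of_deriv_nonneg hcm.2 h1 h2 hc hμ hc0
      (fun t ht => hconv t ⟨hcm.1.trans ht.1, ht.2⟩)
  rcases le_total 0 (θ' a) with h | h
  · exact (right a ⟨le_rfl, hab⟩ h).trans h36
  rcases le_total (θ' b) 0 with h' | h'
  · exact (left b ⟨hab, le_rfl⟩ h').trans h36
  obtain ⟨c, hcm, hc0⟩ := intermediate_value_Icc hab c1.continuousOn ⟨h, h'⟩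
  rw [← intervalIntegral.integral_add_adjacent_intervals (b := c)
    (cE.intervalIntegrable _ _) (cE.intervalIntegrable _ _)]
  calc _ ≤ _ := norm_add_le _ _
    _ ≤ 3 / √μ + 3 / √μ := add_le_add (left c hcm hc0.le) (right c hcm hc0.ge)
    _ = 6 / √μ := by ring

/-- Van der Corput's second derivative test with an amplitude `ψ` satisfying `|ψ b| ≤ A` and
`|ψ'| ≤ g'` where the increment of `g` is at most `B`. -/
theorem norm_integral_exp_mul_le {θ θ' θ'' : ℝ → ℝ} {a b μ : ℝ} (hab : a ≤ b)
    (h1 : ∀ t, HasDerivAt θ (θ' t) t) (h2 : ∀ t, HasDerivAt θ' (θ'' t) t)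
    (hc : Continuous θ'') (hμ : 0 < μ) (hconv : ∀ t ∈ Set.Icc a b, μ ≤ θ'' t)
    {ψ ψ' : ℝ → ℂ} {g g' : ℝ → ℝ} {A B : ℝ}
    (hψ : ∀ t ∈ Set.Icc a b, HasDerivAt ψ (ψ' t) t) (hψc : ContinuousOn ψ' (Set.Icc a b))
    (hg : ∀ t ∈ Set.Icc a b, HasDerivAt g (g' t) t) (hgc : ContinuousOn g' (Set.Icc a b))
    (hψg : ∀ t ∈ Set.Icc a b, ‖ψ' t‖ ≤ g' t) (hA : ‖ψ b‖ ≤ A) (hB : g b - g a ≤ B) :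
    ‖∫ t in a..b, Complex.exp (Complex.I * (θ t : ℂ)) * ψ t‖ ≤ 6 / √μ * (A + B) := by
  have c0 : Continuous θ := continuous_iff_continuousAt.2 fun t => (h1 t).continuousAt
  set E : ℝ → ℂ := fun t => Complex.exp (Complex.I * (θ t : ℂ)) with hE
  have cE : Continuous E := by fun_prop
  set F : ℝ → ℂ := fun t => ∫ s in a..t, E s with hF
  have dF : ∀ t, HasDerivAt F (E t) t := fun t =>
    intervalIntegral.integral_hasDerivAt_right (cE.intervalIntegrable _ _)
      cE.stronglyMeasurable.stronglyMeasurableAtFilter cE.continuousAt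
  have bF : ∀ t ∈ Set.Icc a b, ‖F t‖ ≤ 6 / √μ := fun t ht =>
    norm_integral_exp_le_of_le_deriv2 ht.1 h1 h2 hc hμ
      (fun s hs => hconv s ⟨hs.1, hs.2.trans ht.2⟩)
  have cF : Continuous F := continuous_iff_continuousAt.2 fun t => (dF t).continuousAt
  rw [← Set.uIcc_of_le hab] at hψc hgc
  have parts : ∫ t in a..b, (E t * ψ t + F t * ψ' t) = F b * ψ b - F a * ψ a :=
    intervalIntegral.integral_deriv_mul_eq_sub (fun t _ => dF t)
      (fun t ht => hψ t (by rwa [Set.uIcc_of_le hab] at ht))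
      (cE.intervalIntegrable _ _) hψc.intervalIntegrable
  have cψ : ContinuousOn ψ (Set.uIcc a b) := fun t ht =>
    (hψ t (by rwa [Set.uIcc_of_le hab] at ht)).continuousAt.continuousWithinAt
  have int1 : IntervalIntegrable (fun t => E t * ψ t) volume a b :=
    (cE.continuousOn.mul cψ).intervalIntegrable
  have int2 : IntervalIntegrable (fun t => F t * ψ' t) volume a b :=
    (cF.continuousOn.mul hψc).intervalIntegrable
  rw [intervalIntegral.integral_add int1 int2] at parts
  have F0 : F a = 0 := by simp [hF]
  rw [F0, zero_mul, sub_zero] at parts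
  have gint := intervalIntegral.integral_eq_sub_of_hasDerivAt
    (fun t ht => hg t (by rwa [Set.uIcc_of_le hab] at ht)) hgc.intervalIntegrable
  have b2 : ‖∫ t in a..b, F t * ψ' t‖ ≤ 6 / √μ * (g b - g a) := by
    calc _ ≤ ∫ t in a..b, 6 / √μ * g' t := by
          apply intervalIntegral.norm_integral_le_of_norm_le hab
          · refine ae_of_all _ fun t ht => ?_
            have ht' : t ∈ Set.Icc a b := Set.Ioc_subset_Icc_self ht
            rw [norm_mul]
            exact mul_le_mul (bF t ht') (hψg t ht') (norm_nonneg _) (by positivity)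
          · exact hgc.intervalIntegrable.const_mul _
      _ = _ := by rw [intervalIntegral.integral_const_mul, gint]
  have hpos : 0 ≤ 6 / √μ := by positivity
  rw [eq_sub_of_add_eq parts]
  calc _ ≤ ‖F b * ψ b‖ + _ := norm_sub_le _ _
    _ ≤ 6 / √μ * A + 6 / √μ * (g b - g a) := by
        refine add_le_add ?_ b2
        rw [norm_mul]
        exact mul_le_mul (bF b ⟨hab, le_rfl⟩) hA (norm_nonneg _) hpos
    _ ≤ 6 / √μ * (A + B) := by rw [mul_add]; gcongr

/-! ### Plancherel's theorem and convolution operators on `L²` -/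

open FourierTransform SchwartzMap in
/-- The Fourier integral is symmetric against Schwartz functions. -/
theorem integral_fourier_schwartz_smul {G : ℝ → ℂ} (hG : Integrable G) (s : 𝓢(ℝ, ℂ)) :
    ∫ x, (𝓕 s) x • G x = ∫ x, s x • 𝓕 G x := by
  rw [SchwartzMap.fourier_coe]
  simpa using! VectorFourier.integral_fourierIntegral_smul_eq_flip (L := innerₗ ℝ)
    Real.continuous_fourierChar continuous_inner (s.integrable (μ := volume)) hG

theorem continuous_fourier_of_integrable {G : ℝ → ℂ} (hG : Integrable G) :
    Continuous (FourierTransform.fourier G) :=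
  VectorFourier.fourierIntegral_continuous Real.continuous_fourierChar
    (by exact continuous_inner) hG

open SchwartzMap in
/-- Two locally integrable functions with the same integrals against Schwartz functions agree
almost everywhere. -/
theorem ae_eq_of_integral_schwartz_smul {f g : ℝ → ℂ} (hf : LocallyIntegrable f)
    (hg : LocallyIntegrable g) (h : ∀ s : 𝓢(ℝ, ℂ), ∫ x, s x • f x = ∫ x, s x • g x) :
    f =ᵐ[volume] g := by
  refine ae_eq_of_integral_contDiff_smul_eq hf hg fun φ hφ hφc => ?_
  have hc : HasCompactSupport (fun x => (φ x : ℂ)) :=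
    hφc.comp_left (g := fun x : ℝ => (x : ℂ)) (by simp)
  exact h (hc.toSchwartzMap (Complex.ofRealCLM.contDiff.comp hφ))

open FourierTransform SchwartzMap in
/-- Plancherel's theorem for the Fourier integral on `L¹ ∩ L²`. -/
theorem eLpNorm_fourier_eq {h : ℝ → ℂ} (h1 : Integrable h) (h2 : MemLp h 2) :
    MemLp (𝓕 h) 2 ∧ eLpNorm (𝓕 h) 2 volume = eLpNorm h 2 volume := by
  set H : Lp ℂ 2 (volume : Measure ℝ) := 𝓕 (h2.toLp h) with hH
  have hae : (H : ℝ → ℂ) =ᵐ[volume] 𝓕 h := by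
    refine ae_eq_of_integral_schwartz_smul ((Lp.memLp H).locallyIntegrable (by norm_num))
      (continuous_fourier_of_integrable h1).locallyIntegrable fun s => ?_
    have e := congrArg (fun T => T s) (Lp.fourier_toTemperedDistribution_eq (h2.toLp h))
    simp only [TemperedDistribution.fourier_apply, Lp.toTemperedDistribution_apply] at e
    rw [hH, ← e, ← integral_fourier_schwartz_smul h1]
    refine integral_congr_ae ?_
    filter_upwards [h2.coeFn_toLp] with x hx
    rw [hx]
  refine ⟨(memLp_congr_ae hae).1 (Lp.memLp H), ?_⟩
  rw [← eLpNorm_congr_ae hae, ← eLpNorm_congr_ae h2.coeFn_toLp]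
  have := Lp.norm_fourier_eq (h2.toLp h)
  rw [← hH, Lp.norm_def, Lp.norm_def] at this
  exact (ENNReal.toReal_eq_toReal_iff' (Lp.eLpNorm_ne_top _) (Lp.eLpNorm_ne_top _)).1 this

open FourierTransform SchwartzMap in
/-- An integrable function whose Fourier transform is in `L²` is itself in `L²`. -/
theorem eLpNorm_eq_of_fourier_memLp {G : ℝ → ℂ} (h1 : Integrable G) (h2 : MemLp (𝓕 G) 2) :
    MemLp G 2 ∧ eLpNorm G 2 volume = eLpNorm (𝓕 G) 2 volume := by
  set H : Lp ℂ 2 (volume : Measure ℝ) := 𝓕⁻ (h2.toLp (𝓕 G)) with hH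
  have hae : (H : ℝ → ℂ) =ᵐ[volume] G := by
    refine ae_eq_of_integral_schwartz_smul ((Lp.memLp H).locallyIntegrable (by norm_num))
      h1.locallyIntegrable fun s => ?_
    have e := congrArg (fun T => T s) (Lp.fourierInv_toTemperedDistribution_eq (h2.toLp (𝓕 G)))
    simp only [TemperedDistribution.fourierInv_apply, Lp.toTemperedDistribution_apply] at e
    rw [hH, ← e]
    trans ∫ x, (𝓕 (𝓕⁻ s)) x • G x
    · rw [integral_fourier_schwartz_smul h1]
      refine integral_congr_ae ?_
      filter_upwards [h2.coeFn_toLp] with x hx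
      rw [hx]
    · rw [fourier_fourierInv_eq]
  refine ⟨(memLp_congr_ae hae).1 (Lp.memLp H), ?_⟩
  rw [← eLpNorm_congr_ae hae, ← eLpNorm_congr_ae h2.coeFn_toLp]
  have := Lp.norm_fourier_eq H
  rw [hH, fourier_fourierInv_eq, ← hH, Lp.norm_def, Lp.norm_def] at this
  exact ((ENNReal.toReal_eq_toReal_iff' (Lp.eLpNorm_ne_top _) (Lp.eLpNorm_ne_top _)).1 this).symm

open FourierTransform Convolution in
/-- Convolution with an integrable kernel acts on `L¹ ∩ L²` as a Fourier multiplier. -/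
theorem eLpNorm_convolution_le {k f : ℝ → ℂ} {M : ℝ} (hk : Integrable k)
    (hM : ∀ ξ, ‖𝓕 k ξ‖ ≤ M) (hf1 : Integrable f) (hf2 : MemLp f 2) :
    eLpNorm (fun x => ∫ y, k (x - y) * f y) 2 volume ≤ ENNReal.ofReal M * eLpNorm f 2 volume := by
  have hM0 : 0 ≤ M := (norm_nonneg _).trans (hM 0)
  have hcomm : (fun x => ∫ y, k (x - y) * f y) = f ⋆[ContinuousLinearMap.mul ℂ ℂ] k := by
    ext x
    simp only [convolution_def, ContinuousLinearMap.mul_apply']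
    exact integral_congr_ae (ae_of_all _ fun y => mul_comm _ _)
  rw [hcomm]
  have hF : 𝓕 (f ⋆[ContinuousLinearMap.mul ℂ ℂ] k) = fun ξ => 𝓕 f ξ * 𝓕 k ξ :=
    funext fun ξ => Real.fourier_mul_convolution_eq hf1 hk ξ
  have hle : ∀ ξ, ‖𝓕 f ξ * 𝓕 k ξ‖ ≤ M * ‖𝓕 f ξ‖ := fun ξ => by
    rw [norm_mul, mul_comm]
    exact mul_le_mul_of_nonneg_right (hM ξ) (norm_nonneg _)
  obtain ⟨m, e⟩ := eLpNorm_fourier_eq hf1 hf2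
  have hmem : MemLp (𝓕 (f ⋆[ContinuousLinearMap.mul ℂ ℂ] k)) 2 := by
    rw [hF]
    exact m.of_le_mul ((continuous_fourier_of_integrable hf1).mul
      (continuous_fourier_of_integrable hk)).aestronglyMeasurable (ae_of_all _ hle)
  rw [(eLpNorm_eq_of_fourier_memLp (hf1.integrable_convolution _ hk) hmem).2, hF, ← e]
  exact eLpNorm_le_mul_eLpNorm_of_ae_le_mul (ae_of_all _ hle) 2

theorem integrable_conv_of_memLp_two {k f : ℝ → ℂ} (hk : MemLp k 2) (hf : MemLp f 2) (x : ℝ) :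
    Integrable fun y => k (x - y) * f y :=
  (hk.comp_measurePreserving (Measure.measurePreserving_sub_left volume x)).integrable_mul hf

theorem aestronglyMeasurable_conv {k f : ℝ → ℂ} (hk : Measurable k)
    (hf : AEStronglyMeasurable f) :
    AEStronglyMeasurable fun x => ∫ y, k (x - y) * f y := by
  refine AEStronglyMeasurable.integral_prod_right' (f := fun p : ℝ × ℝ => k (p.1 - p.2) * f p.2)
    (μ := volume) (ν := volume) ?_
  exact (hk.comp (measurable_fst.sub measurable_snd)).aestronglyMeasurable.mul hf.comp_snd

/-- Convolution with a square integrable kernel whose truncations to `[-N, N]` have uniformly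
bounded Fourier transforms is bounded on `L²`, by Fatou's lemma. -/
theorem eLpNorm_conv_le_of_truncations {k f : ℝ → ℂ} {M : ℝ} (hkm : Measurable k)
    (hk : MemLp k 2)
    (hM : ∀ᶠ N : ℕ in atTop, ∀ ξ,
      ‖FourierTransform.fourier ({t : ℝ | |t| ≤ N}.indicator k) ξ‖ ≤ M)
    (hf : MemLp f 2) :
    eLpNorm (fun x => ∫ y, k (x - y) * f y) 2 volume ≤ ENNReal.ofReal M * eLpNorm f 2 volume := by
  have hS : ∀ N : ℕ, MeasurableSet {t : ℝ | |t| ≤ N} := fun N =>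
    measurableSet_le measurable_id.abs measurable_const
  have hfin : ∀ N : ℕ, volume {t : ℝ | |t| ≤ N} ≠ ⊤ := fun N => by
    have : {t : ℝ | |t| ≤ N} = Set.Icc (-(N : ℝ)) N := by ext; simp [abs_le]
    rw [this]; simp
  have hloc : ∀ g : ℝ → ℂ, MemLp g 2 → ∀ N : ℕ, Integrable ({t : ℝ | |t| ≤ N}.indicator g) := by
    intro g hg N
    rw [integrable_indicator_iff (hS N)]
    have : IsFiniteMeasure (volume.restrict {t : ℝ | |t| ≤ N}) :=
      ⟨by simpa using (hfin N).lt_top⟩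
    exact (hg.restrict _).integrable (by norm_num)
  have hind : ∀ (g : ℝ → ℂ) (t : ℝ),
      ∀ᶠ N : ℕ in atTop, {t : ℝ | |t| ≤ N}.indicator g t = g t := by
    intro g t
    filter_upwards [eventually_ge_atTop ⌈|t|⌉₊] with N hN
    have ht : t ∈ {t : ℝ | |t| ≤ N} := Nat.ceil_le.1 hN
    exact Set.indicator_of_mem ht g
  have hlim : ∀ x, Tendsto (fun N : ℕ => ∫ y, {t : ℝ | |t| ≤ N}.indicator k (x - y) *
      {t : ℝ | |t| ≤ N}.indicator f y) atTop (𝓝 (∫ y, k (x - y) * f y)) := by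
    intro x
    refine tendsto_integral_of_dominated_convergence (fun y => ‖k (x - y) * f y‖) ?_
      (integrable_conv_of_memLp_two hk hf x).norm ?_ ?_
    · intro N
      exact ((hkm.indicator (hS N)).comp
        (measurable_const.sub measurable_id)).aestronglyMeasurable.mul
        (hf.aestronglyMeasurable.indicator (hS N))
    · refine fun N => ae_of_all _ fun y => ?_
      rw [norm_mul, norm_mul]
      exact mul_le_mul (norm_indicator_le_norm_self _ _) (norm_indicator_le_norm_self _ _)
        (norm_nonneg _) (norm_nonneg _)
    · refine ae_of_all _ fun y => tendsto_const_nhds.congr' ?_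
      filter_upwards [hind k (x - y), hind f y] with N h1 h2
      rw [h1, h2]
  refine Lp.eLpNorm_le_of_ae_tendsto (u := atTop) ?_ (fun N => ?_) (ae_of_all _ hlim)
  · filter_upwards [hM] with N hN
    refine (eLpNorm_convolution_le (hloc k hk N) hN (hloc f hf N)
      (hf.indicator (hS N))).trans ?_
    gcongr
    exact eLpNorm_indicator_le _
  · exact aestronglyMeasurable_conv (hkm.indicator (hS N))
      (hf.aestronglyMeasurable.indicator (hS N))

/-! ### The oscillatory kernel and its truncated Fourier transform -/

/-- The convolution kernel `e^{i l t^n} (δ + |t|)^z`. Both operators are built from it: `l = δ = 1`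
gives `transInvKernel`, and `δ = |l|^{-1/n}` gives `cutoffKernel` up to the cutoff. -/
noncomputable def oscKernel (n : ℕ) (l δ : ℝ) (z : ℂ) (t : ℝ) : ℂ :=
  Complex.exp (Complex.I * ((l * t ^ n : ℝ) : ℂ)) * ((δ + |t| : ℝ) : ℂ) ^ z

theorem norm_ofReal_cpow_of_re_eq {z : ℂ} (hz : z.re = -1) {x : ℝ} (hx : 0 < x) :
    ‖(x : ℂ) ^ z‖ = x⁻¹ := by
  rw [Complex.norm_cpow_eq_rpow_re_of_pos hx, hz, Real.rpow_neg_one]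

theorem norm_oscKernel {n : ℕ} {l δ : ℝ} {z : ℂ} (hδ : 0 < δ) (hz : z.re = -1) (t : ℝ) :
    ‖oscKernel n l δ z t‖ = (δ + |t|)⁻¹ := by
  rw [oscKernel, norm_mul, norm_exp_I_mul_ofReal, one_mul,
    norm_ofReal_cpow_of_re_eq hz (by positivity)]

theorem continuous_oscKernel {n : ℕ} {l δ : ℝ} {z : ℂ} (hδ : 0 < δ) :
    Continuous (oscKernel n l δ z) := by
  unfold oscKernel
  refine Continuous.mul (by fun_prop) ?_
  refine Continuous.cpow (by fun_prop) continuous_const fun t => ?_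
  exact Or.inl (by rw [Complex.ofReal_re]; positivity)

theorem memLp_oscKernel {n : ℕ} {l δ : ℝ} {z : ℂ} (hδ : 0 < δ) (hz : z.re = -1) :
    MemLp (oscKernel n l δ z) 2 := by
  have hm := (continuous_oscKernel (n := n) (l := l) (z := z) hδ).aestronglyMeasurable
    (μ := (volume : Measure ℝ))
  rw [memLp_two_iff_integrable_sq_norm hm]
  refine (integrable_inv_one_add_sq.const_mul ((1 + δ⁻¹) ^ 2)).mono' (hm.norm.pow 2) ?_
  refine ae_of_all _ fun t => ?_
  have ht : 0 < δ + |t| := by positivity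
  rw [norm_oscKernel hδ hz, Real.norm_eq_abs, abs_of_nonneg (by positivity), inv_pow,
    inv_le_iff_one_le_mul₀ (by positivity), mul_assoc, ← div_eq_inv_mul, ← mul_div_assoc,
    le_div_iff₀ (by positivity), one_mul]
  have h1 : 1 + |t| ≤ (1 + δ⁻¹) * (δ + |t|) := by
    have : δ⁻¹ * δ = 1 := inv_mul_cancel₀ hδ.ne'
    have : 0 ≤ δ⁻¹ * |t| := by positivity
    nlinarith
  calc 1 + t ^ 2 ≤ (1 + |t|) ^ 2 := by nlinarith [sq_abs t, abs_nonneg t]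
    _ ≤ ((1 + δ⁻¹) * (δ + |t|)) ^ 2 := by gcongr
    _ = _ := by ring

theorem norm_le_one_add_abs_im {z : ℂ} (hz : z.re = -1) : ‖z‖ ≤ 1 + |z.im| := by
  have := Complex.norm_le_abs_re_add_abs_im z
  rwa [hz, abs_neg, abs_one] at this

theorem hasDerivAt_shift_cpow {z : ℂ} (hz : z.re = -1) {δ t : ℝ} (ht : 0 < δ + t) :
    HasDerivAt (fun s : ℝ => ((δ + s : ℝ) : ℂ) ^ z) (z * ((δ + t : ℝ) : ℂ) ^ (z - 1)) t := by
  have hz0 : z ≠ 0 := by rintro rfl; norm_num at hz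
  simpa [Function.comp_def] using
    (hasDerivAt_ofReal_cpow_const ht.ne' hz0).scomp t ((hasDerivAt_id t).const_add δ)

theorem norm_shift_cpow_deriv {z : ℂ} (hz : z.re = -1) {x : ℝ} (hx : 0 < x) :
    ‖z * (x : ℂ) ^ (z - 1)‖ = ‖z‖ / x ^ 2 := by
  rw [norm_mul, Complex.norm_cpow_eq_rpow_re_of_pos hx, Complex.sub_re, hz, Complex.one_re,
    div_eq_mul_inv]
  rw [← Real.rpow_natCast, ← Real.rpow_neg hx.le]
  norm_num

/-- The frequency-uniform estimate on `[α, β]` for `l > 0`: the linear term of the phase does not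
affect its second derivative, which is at least `l α^{n-2}`. -/
theorem norm_integral_osc_le_of_pos {n : ℕ} (hn : 2 ≤ n) {l : ℝ} (hl : 0 < l) {δ α β : ℝ}
    (hδ : 0 ≤ δ) (hα : 0 < α) (hαβ : α ≤ β) {z : ℂ} (hz : z.re = -1) (η : ℝ) :
    ‖∫ t in α..β, Complex.exp (Complex.I * ((l * t ^ n + η * t : ℝ) : ℂ)) *
      ((δ + t : ℝ) : ℂ) ^ z‖ ≤ 12 * (1 + |z.im|) / (√(l * α ^ (n - 2)) * (δ + α)) := by
  have hpos : ∀ t ∈ Set.Icc α β, 0 < δ + t := fun t ht => by linarith [ht.1]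
  have hs : 0 < √(l * α ^ (n - 2)) := Real.sqrt_pos.2 (by positivity)
  have hδα : 0 < δ + α := by positivity
  have h1 : ∀ t, HasDerivAt (fun t : ℝ => l * t ^ n + η * t) (l * (n * t ^ (n - 1)) + η) t :=
    fun t => by
      simpa using! ((hasDerivAt_pow n t).const_mul l).add ((hasDerivAt_id t).const_mul η)
  have h2 : ∀ t, HasDerivAt (fun t : ℝ => l * (n * t ^ (n - 1)) + η)
      (l * (n * ((n - 1 : ℕ) * t ^ (n - 2)))) t := fun t => by
    simpa [Nat.sub_sub] using
      (((hasDerivAt_pow (n - 1) t).const_mul (n : ℝ)).const_mul l).add_const η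
  have hconv : ∀ t ∈ Set.Icc α β,
      l * α ^ (n - 2) ≤ l * (n * ((n - 1 : ℕ) * t ^ (n - 2))) := by
    intro t ht
    have e1 : (1 : ℝ) ≤ n := by exact_mod_cast (by lia : 1 ≤ n)
    have e2 : (1 : ℝ) ≤ (n - 1 : ℕ) := by exact_mod_cast (by lia : 1 ≤ n - 1)
    have e3 : α ^ (n - 2) ≤ t ^ (n - 2) := pow_le_pow_left₀ hα.le ht.1 _
    have e4 : 0 ≤ t ^ (n - 2) := by have := hα.trans_le ht.1; positivity
    refine mul_le_mul_of_nonneg_left ?_ hl.le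
    calc α ^ (n - 2) ≤ 1 * (1 * t ^ (n - 2)) := by simpa using e3
      _ ≤ _ := by gcongr
  have hz1 := norm_le_one_add_abs_im hz
  have main := norm_integral_exp_mul_le hαβ h1 h2 (by fun_prop) (by positivity) hconv
    (ψ := fun t => ((δ + t : ℝ) : ℂ) ^ z) (ψ' := fun t => z * ((δ + t : ℝ) : ℂ) ^ (z - 1))
    (g := fun t => -(‖z‖ * (δ + t)⁻¹)) (g' := fun t => ‖z‖ / (δ + t) ^ 2)
    (A := (δ + α)⁻¹) (B := ‖z‖ * (δ + α)⁻¹)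
    (fun t ht => hasDerivAt_shift_cpow hz (hpos t ht))
    (by
      refine continuousOn_const.mul (ContinuousOn.cpow (by fun_prop) continuousOn_const ?_)
      exact fun t ht => Or.inl (by rw [Complex.ofReal_re]; exact hpos t ht))
    (by
      intro t ht
      have hd : HasDerivAt (fun t : ℝ => (δ + t)⁻¹) (-1 / (δ + t) ^ 2) t :=
        ((hasDerivAt_id t).const_add δ).inv (hpos t ht).ne'
      refine ((hd.const_mul ‖z‖).neg).congr_deriv ?_
      ring)
    (continuousOn_const.div (by fun_prop) fun t ht => by have := hpos t ht; positivity)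
    (fun t ht => (norm_shift_cpow_deriv hz (hpos t ht)).le)
    (by
      rw [norm_ofReal_cpow_of_re_eq hz (hpos β ⟨hαβ, le_rfl⟩)]
      exact inv_anti₀ hδα (by linarith))
    (by
      have : 0 ≤ ‖z‖ * (δ + β)⁻¹ := by have := hpos β ⟨hαβ, le_rfl⟩; positivity
      linarith)
  refine main.trans ?_
  calc 6 / √(l * α ^ (n - 2)) * ((δ + α)⁻¹ + ‖z‖ * (δ + α)⁻¹)
      ≤ 6 / √(l * α ^ (n - 2)) * ((1 + |z.im|) * (δ + α)⁻¹ + (1 + |z.im|) * (δ + α)⁻¹) := by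
        gcongr
        exact le_mul_of_one_le_left (by positivity) (by linarith [abs_nonneg z.im])
    _ = _ := by field_simp; ring

theorem norm_integral_osc_le {n : ℕ} (hn : 2 ≤ n) {l : ℝ} (hl : l ≠ 0) {δ α β : ℝ}
    (hδ : 0 ≤ δ) (hα : 0 < α) (hαβ : α ≤ β) {z : ℂ} (hz : z.re = -1) (η : ℝ) :
    ‖∫ t in α..β, Complex.exp (Complex.I * ((l * t ^ n + η * t : ℝ) : ℂ)) *
      ((δ + t : ℝ) : ℂ) ^ z‖ ≤ 12 * (1 + |z.im|) / (√(|l| * α ^ (n - 2)) * (δ + α)) := by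
  rcases lt_or_gt_of_ne hl with h | h
  · -- complex conjugation changes the signs of `l` and `η`
    have key := norm_integral_osc_le_of_pos hn (neg_pos.2 h) hδ hα hαβ
      (z := (starRingEnd ℂ) z) (by simpa using hz) (-η)
    rw [Complex.conj_im, abs_neg, ← abs_of_neg h] at key
    refine le_trans (le_of_eq ?_) key
    rw [← Complex.norm_conj, intervalIntegral.integral_of_le hαβ,
      intervalIntegral.integral_of_le hαβ, ← integral_conj]
    congr 1
    refine setIntegral_congr_fun measurableSet_Ioc fun t ht => ?_
    have ht0 : 0 ≤ δ + t := by linarith [ht.1]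
    have harg : ((δ + t : ℝ) : ℂ).arg ≠ Real.pi := by
      rw [Complex.arg_ofReal_of_nonneg ht0]; exact Real.pi_pos.ne
    simp only [map_mul]
    rw [← Complex.exp_conj, Complex.cpow_conj _ _ harg, Complex.conj_ofReal, map_mul,
      Complex.conj_I, Complex.conj_ofReal]
    congr 2
    rw [abs_of_neg h]
    push_cast; ring
  · rw [abs_of_pos h]
    exact norm_integral_osc_le_of_pos hn h hδ hα hαβ hz η

theorem fourier_indicator_eq (k : ℝ → ℂ) {S : Set ℝ} (hS : MeasurableSet S) (ξ : ℝ) :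
    FourierTransform.fourier (S.indicator k) ξ =
      ∫ t in S, Complex.exp (Complex.I * ((-2 * Real.pi * ξ * t : ℝ) : ℂ)) * k t := by
  rw [Real.fourier_real_eq_integral_exp_smul, ← integral_indicator hS]
  congr 1
  ext t
  by_cases ht : t ∈ S
  · rw [Set.indicator_of_mem ht, Set.indicator_of_mem ht, smul_eq_mul, mul_comm Complex.I]
    congr 4
    ring
  · simp [Set.indicator_of_notMem ht]

theorem setOf_le_abs_le_eq_union {α : ℝ} (hα : 0 < α) (β : ℝ) :
    {t : ℝ | α ≤ |t| ∧ |t| ≤ β} = Set.Icc α β ∪ Set.Icc (-β) (-α) := by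
  ext t
  simp only [Set.mem_ofPred_eq, Set.mem_union, Set.mem_Icc]
  rcases le_total 0 t with h | h
  · rw [abs_of_nonneg h]
    grind
  · rw [abs_of_nonpos h]
    grind

theorem measurableSet_setOf_le_abs_le (α β : ℝ) : MeasurableSet {t : ℝ | α ≤ |t| ∧ |t| ≤ β} :=
  (measurableSet_le measurable_const measurable_id.abs).inter
    (measurableSet_le measurable_id.abs measurable_const)

/-- The part of the kernel in `α ≤ |t| ≤ β` has Fourier transform
`O((1 + |Im z|) |l|^{-1/2} α^{-n/2})`, uniformly in `β` and the frequency. -/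
theorem norm_fourier_annulus_le {n : ℕ} (hn : 2 ≤ n) {l : ℝ} (hl : l ≠ 0) {δ α β : ℝ}
    (hδ : 0 < δ) (hα : 0 < α) (hαβ : α ≤ β) {z : ℂ} (hz : z.re = -1) (ξ : ℝ) :
    ‖FourierTransform.fourier ({t : ℝ | α ≤ |t| ∧ |t| ≤ β}.indicator (oscKernel n l δ z)) ξ‖
      ≤ 24 * (1 + |z.im|) / (√(|l| * α ^ (n - 2)) * (δ + α)) := by
  set F : ℝ → ℂ := fun t => Complex.exp (Complex.I * ((-2 * Real.pi * ξ * t : ℝ) : ℂ)) *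
    oscKernel n l δ z t with hF
  have cF : Continuous F := Continuous.mul (by fun_prop) (continuous_oscKernel hδ)
  have hdis : Disjoint (Set.Icc α β) (Set.Icc (-β) (-α)) := by
    rw [Set.disjoint_left]
    intro t h1 h2
    linarith [h1.1, h2.2]
  rw [fourier_indicator_eq _ (measurableSet_setOf_le_abs_le α β), setOf_le_abs_le_eq_union hα,
    setIntegral_union hdis measurableSet_Icc cF.continuousOn.integrableOn_Icc
      cF.continuousOn.integrableOn_Icc, integral_Icc_eq_integral_Ioc,
    integral_Icc_eq_integral_Ioc, ← intervalIntegral.integral_of_le hαβ,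
    ← intervalIntegral.integral_of_le (neg_le_neg hαβ), ← intervalIntegral.integral_comp_neg]
  have e1 : ∫ t in α..β, F t = ∫ t in α..β, Complex.exp (Complex.I *
      ((l * t ^ n + (-2 * Real.pi * ξ) * t : ℝ) : ℂ)) * ((δ + t : ℝ) : ℂ) ^ z := by
    refine intervalIntegral.integral_congr fun t ht => ?_
    rw [Set.uIcc_of_le hαβ] at ht
    simp only [hF, oscKernel]
    rw [abs_of_pos (hα.trans_le ht.1), ← mul_assoc, ← Complex.exp_add, ← mul_add,
      ← Complex.ofReal_add]
    congr 4
    ring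
  have e2 : ∫ t in α..β, F (-t) = ∫ t in α..β, Complex.exp (Complex.I *
      (((l * (-1) ^ n) * t ^ n + (2 * Real.pi * ξ) * t : ℝ) : ℂ)) * ((δ + t : ℝ) : ℂ) ^ z := by
    refine intervalIntegral.integral_congr fun t ht => ?_
    rw [Set.uIcc_of_le hαβ] at ht
    simp only [hF, oscKernel]
    rw [abs_neg, abs_of_pos (hα.trans_le ht.1), ← mul_assoc, ← Complex.exp_add, ← mul_add,
      ← Complex.ofReal_add, neg_pow t]
    congr 4
    ring
  have b1 := norm_integral_osc_le hn hl hδ.le hα hαβ hz (-2 * Real.pi * ξ)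
  have b2 := norm_integral_osc_le hn (l := l * (-1) ^ n)
    (mul_ne_zero hl (pow_ne_zero _ (by norm_num))) hδ.le hα hαβ hz (2 * Real.pi * ξ)
  rw [abs_mul, abs_pow, abs_neg, abs_one, one_pow, mul_one] at b2
  rw [← e1] at b1
  rw [← e2] at b2
  refine (norm_add_le_of_le b1 b2).trans (le_of_eq ?_)
  ring

/-- At the natural scale `|l| δ^n = 1`, the truncations of the kernel to `[-N, N]` have Fourier
transforms bounded independently of `l`: the part `|t| < δ` contributes at most `2`. -/
theorem norm_fourier_truncation_le {n : ℕ} (hn : 2 ≤ n) {l : ℝ} (hl : l ≠ 0) {δ N : ℝ}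
    (hδ : 0 < δ) (hlδ : |l| * δ ^ n = 1) (hN : δ ≤ N) {z : ℂ} (hz : z.re = -1) (ξ : ℝ) :
    ‖FourierTransform.fourier ({t : ℝ | |t| ≤ N}.indicator (oscKernel n l δ z)) ξ‖
      ≤ 14 * (1 + |z.im|) := by
  set F : ℝ → ℂ := fun t => Complex.exp (Complex.I * ((-2 * Real.pi * ξ * t : ℝ) : ℂ)) *
    oscKernel n l δ z t with hF
  have cF : Continuous F := Continuous.mul (by fun_prop) (continuous_oscKernel hδ)
  have hsplit : {t : ℝ | |t| ≤ N} = Set.Ioo (-δ) δ ∪ {t : ℝ | δ ≤ |t| ∧ |t| ≤ N} := by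
    ext t
    simp only [Set.mem_ofPred_eq, Set.mem_union, Set.mem_Ioo, ← abs_lt]
    grind
  have hdis : Disjoint (Set.Ioo (-δ) δ) {t : ℝ | δ ≤ |t| ∧ |t| ≤ N} := by
    rw [Set.disjoint_left]
    intro t h1 h2
    exact absurd (abs_lt.2 h1) (not_lt.2 h2.1)
  have i1 : IntegrableOn F (Set.Ioo (-δ) δ) :=
    (cF.continuousOn.integrableOn_Icc (a := -δ) (b := δ)).mono_set Set.Ioo_subset_Icc_self
  have i2 : IntegrableOn F {t : ℝ | δ ≤ |t| ∧ |t| ≤ N} := by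
    rw [setOf_le_abs_le_eq_union hδ]
    exact cF.continuousOn.integrableOn_Icc.union cF.continuousOn.integrableOn_Icc
  have hS : MeasurableSet {t : ℝ | |t| ≤ N} := measurableSet_le measurable_id.abs measurable_const
  rw [fourier_indicator_eq _ hS, hsplit,
    setIntegral_union hdis (measurableSet_setOf_le_abs_le δ N) i1 i2]
  have b1 : ‖∫ t in Set.Ioo (-δ) δ, F t‖ ≤ 2 := by
    have := norm_setIntegral_le_of_norm_le_const (μ := volume) (s := Set.Ioo (-δ) δ) (f := F)
      (C := δ⁻¹) (by simp) (fun t _ => by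
        rw [hF, norm_mul, norm_exp_I_mul_ofReal, one_mul, norm_oscKernel hδ hz]
        exact inv_anti₀ hδ (by linarith [abs_nonneg t]))
    rw [Real.volume_real_Ioo_of_le (by linarith)] at this
    refine this.trans (le_of_eq ?_)
    field_simp; ring
  have b2 := norm_fourier_annulus_le hn hl hδ hδ hN hz ξ
  rw [fourier_indicator_eq _ (measurableSet_setOf_le_abs_le δ N)] at b2
  have hs : √(|l| * δ ^ (n - 2)) * (δ + δ) = 2 := by
    have h1 : √(|l| * δ ^ (n - 2)) * δ = 1 := by
      rw [← Real.sqrt_sq hδ.le, ← Real.sqrt_mul (by positivity), Real.sqrt_sq hδ.le, mul_assoc,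
        ← pow_add, Nat.sub_add_cancel hn, hlδ, Real.sqrt_one]
    linarith
  rw [hs] at b2
  refine (norm_add_le_of_le b1 b2).trans ?_
  linarith [abs_nonneg z.im]

/-- `L²` boundedness of convolution with `oscKernel`, uniformly in `l` at the natural scale. -/
theorem eLpNorm_oscKernel_conv_le {n : ℕ} (hn : 2 ≤ n) {l : ℝ} (hl : l ≠ 0) {δ : ℝ}
    (hδ : 0 < δ) (hlδ : |l| * δ ^ n = 1) {z : ℂ} (hz : z.re = -1) {f : ℝ → ℂ} (hf : MemLp f 2) :
    eLpNorm (fun x => ∫ y, oscKernel n l δ z (x - y) * f y) 2 volume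
      ≤ ENNReal.ofReal (14 * (1 + |z.im|)) * eLpNorm f 2 volume := by
  refine eLpNorm_conv_le_of_truncations (continuous_oscKernel hδ).measurable
    (memLp_oscKernel hδ hz) ?_ hf
  filter_upwards [eventually_ge_atTop ⌈δ⌉₊] with N hN ξ
  exact norm_fourier_truncation_le hn hl hδ hlδ (Nat.ceil_le.1 hN) hz ξ

/-! ### Estimates for an atom -/

/-- The Cauchy–Schwarz inequality on a set of finite measure. -/
theorem setLIntegral_enorm_le_of_eLpNorm_two {g : ℝ → ℂ} (hg : AEStronglyMeasurable g) {S : Set ℝ}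
    {V B : ℝ} (hS : volume S ≤ ENNReal.ofReal V) (hB : eLpNorm g 2 volume ≤ ENNReal.ofReal B) :
    ∫⁻ x in S, ‖g x‖ₑ ≤ ENNReal.ofReal (√V * B) := by
  have h := eLpNorm_le_eLpNorm_mul_rpow_measure_univ (μ := volume.restrict S) (p := 1) (q := 2)
    (by norm_num) hg.restrict
  rw [eLpNorm_one_eq_lintegral_enorm, Measure.restrict_apply_univ] at h
  refine h.trans ?_
  rw [ENNReal.ofReal_mul (Real.sqrt_nonneg _), mul_comm (ENNReal.ofReal √V)]
  refine mul_le_mul' ((eLpNorm_mono_measure g Measure.restrict_le_self).trans hB) ?_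
  have he : (1 / (1 : ℝ≥0∞).toReal - 1 / (2 : ℝ≥0∞).toReal) = 1 / 2 := by norm_num
  rw [he]
  refine (ENNReal.rpow_le_rpow hS (by norm_num)).trans ?_
  rcases le_total V 0 with hV | hV
  · rw [ENNReal.ofReal_of_nonpos hV]; simp
  · rw [ENNReal.ofReal_rpow_of_nonneg hV (by norm_num), Real.sqrt_eq_rpow]

theorem memLp_of_ae_bound_of_support {a : ℝ → ℂ} {r : ℝ} (hm : Measurable a)
    (hs : Function.support a ⊆ Set.Icc (-r) r) (hb : ∀ᵐ x, ‖a x‖ ≤ (2 * r)⁻¹) (p : ℝ≥0∞) :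
    MemLp a p := by
  have h1 : MemLp a p (volume.restrict (Set.Icc (-r) r)) :=
    MemLp.of_bound hm.aestronglyMeasurable _ (ae_restrict_of_ae hb)
  have h2 := (memLp_indicator_iff_restrict (f := a) (p := p) (μ := volume)
    (measurableSet_Icc (a := -r) (b := r))).2 h1
  rwa [Set.indicator_eq_self.2 hs] at h2

theorem eLpNorm_two_atom_le {a : ℝ → ℂ} {r : ℝ} (hr : 0 < r)
    (hs : Function.support a ⊆ Set.Icc (-r) r) (hb : ∀ᵐ x, ‖a x‖ ≤ (2 * r)⁻¹) :
    eLpNorm a 2 volume ≤ ENNReal.ofReal (√(2 * r))⁻¹ := by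
  rw [← eLpNorm_restrict_eq_of_support_subset hs]
  refine (eLpNorm_le_of_ae_bound (ae_restrict_of_ae hb)).trans (le_of_eq ?_)
  have h2 : 0 < 2 * r := by positivity
  have : r - -r = 2 * r := by ring
  rw [Measure.restrict_apply_univ, Real.volume_Icc, this, ENNReal.ofReal_rpow_of_nonneg h2.le
    (by norm_num), ← ENNReal.ofReal_mul (by positivity)]
  congr 1
  rw [Real.sqrt_eq_rpow, ← Real.rpow_neg_one (2 * r), ← Real.rpow_add h2, ← Real.rpow_neg h2.le]
  norm_num

theorem integral_norm_atom_le {a : ℝ → ℂ} {r : ℝ} (hr : 0 < r) (hm : Measurable a)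
    (hs : Function.support a ⊆ Set.Icc (-r) r) (hb : ∀ᵐ x, ‖a x‖ ≤ (2 * r)⁻¹) :
    ∫ y, ‖a y‖ ≤ 1 := by
  have hi := (memLp_one_iff_integrable.1 (memLp_of_ae_bound_of_support hm hs hb 1)).norm
  have e : ∫ y, ‖a y‖ = ∫ y in Set.Icc (-r) r, ‖a y‖ := by
    refine (setIntegral_eq_integral_of_forall_compl_eq_zero fun y hy => ?_).symm
    rw [norm_eq_zero]
    by_contra h
    exact hy (hs h)
  rw [e]
  calc _ ≤ ∫ y in Set.Icc (-r) r, (2 * r)⁻¹ :=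
        integral_mono_ae hi.integrableOn (integrable_const _) (ae_restrict_of_ae hb)
    _ = 1 := by
        rw [setIntegral_const, Real.volume_real_Icc_of_le (by linarith), smul_eq_mul]
        field_simp; ring

/-- Near the support of the atom, the `L²` bound suffices. -/
theorem setLIntegral_near_le {n : ℕ} (hn : 2 ≤ n) {z : ℂ} (hz : z.re = -1) {a : ℝ → ℂ} {r : ℝ}
    (hr : 0 < r) (hm : Measurable a) (hs : Function.support a ⊆ Set.Icc (-r) r)
    (hb : ∀ᵐ x, ‖a x‖ ≤ (2 * r)⁻¹) :
    ∫⁻ x in {x : ℝ | |x| ≤ 4 * r}, ‖∫ y, oscKernel n 1 1 z (x - y) * a y‖ₑ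
      ≤ ENNReal.ofReal (28 * (1 + |z.im|)) := by
  have h0 : 0 ≤ 1 + |z.im| := by positivity
  have hL := (eLpNorm_oscKernel_conv_le hn one_ne_zero one_pos (by simp) hz
    (memLp_of_ae_bound_of_support hm hs hb 2)).trans
    (mul_le_mul_right (eLpNorm_two_atom_le hr hs hb) _)
  rw [← ENNReal.ofReal_mul (by positivity)] at hL
  refine (setLIntegral_enorm_le_of_eLpNorm_two (V := 8 * r) (aestronglyMeasurable_conv
    (continuous_oscKernel one_pos).measurable hm.aestronglyMeasurable) ?_ hL).trans (le_of_eq ?_)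
  · have : {x : ℝ | |x| ≤ 4 * r} = Set.Icc (-(4 * r)) (4 * r) := by ext; simp [abs_le]
    rw [this, Real.volume_Icc]
    exact ENNReal.ofReal_le_ofReal (by linarith)
  · congr 1
    have e : √(8 * r) = 2 * √(2 * r) := by
      rw [show 8 * r = 2 ^ 2 * (2 * r) by ring, Real.sqrt_mul (by norm_num),
        Real.sqrt_sq (by norm_num)]
    have : √(2 * r) ≠ 0 := (Real.sqrt_pos.2 (by positivity)).ne'
    rw [e]
    field_simp
    ring

/-- On an annulus `|x| ∼ A` far from the support, only the part `|t| ∼ A` of the kernel is seen,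
and its multiplier norm `O(A^{-n/2})` replaces any use of cancellation. -/
theorem setLIntegral_annulus_le {n : ℕ} (hn : 2 ≤ n) {z : ℂ} (hz : z.re = -1) {a : ℝ → ℂ} {r : ℝ}
    (hr : 0 < r) (hm : Measurable a) (hs : Function.support a ⊆ Set.Icc (-r) r)
    (hb : ∀ᵐ x, ‖a x‖ ≤ (2 * r)⁻¹) {A : ℝ} (hA : 4 * r ≤ A) :
    ∫⁻ x in {x : ℝ | A ≤ |x| ∧ |x| ≤ 4 * A}, ‖∫ y, oscKernel n 1 1 z (x - y) * a y‖ₑ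
      ≤ ENNReal.ofReal (48 * 2 ^ n * (1 + |z.im|) * (√(A ^ (n - 1) * r))⁻¹) := by
  have hA0 : 0 < A := by linarith
  have h0 : 0 ≤ 1 + |z.im| := by positivity
  set S : Set ℝ := {t : ℝ | A / 2 ≤ |t| ∧ |t| ≤ 5 * A} with hSdef
  have hS : MeasurableSet S := measurableSet_setOf_le_abs_le _ _
  set K := S.indicator (oscKernel n 1 1 z) with hK
  have hcont := continuous_oscKernel (n := n) (l := 1) (z := z) one_pos
  have hKi : Integrable K := by
    rw [hK, integrable_indicator_iff hS, hSdef, setOf_le_abs_le_eq_union (by positivity)]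
    exact hcont.continuousOn.integrableOn_Icc.union hcont.continuousOn.integrableOn_Icc
  have hcongr : ∫⁻ x in {x : ℝ | A ≤ |x| ∧ |x| ≤ 4 * A},
      ‖∫ y, oscKernel n 1 1 z (x - y) * a y‖ₑ =
      ∫⁻ x in {x : ℝ | A ≤ |x| ∧ |x| ≤ 4 * A}, ‖∫ y, K (x - y) * a y‖ₑ := by
    refine setLIntegral_congr_fun (measurableSet_setOf_le_abs_le _ _) fun x hx => ?_
    congr 2
    ext y
    by_cases hy : a y = 0
    · simp [hy]
    · have hy' := abs_le.2 (hs hy)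
      have hxy : x - y ∈ S := by
        have e1 := abs_sub_abs_le_abs_sub x y
        have e2 := abs_sub x y
        exact ⟨by linarith [hx.1], by linarith [hx.2]⟩
      rw [hK, Set.indicator_of_mem hxy]
  rw [hcongr]
  have hL := (eLpNorm_convolution_le hKi
    (norm_fourier_annulus_le hn one_ne_zero one_pos (by positivity : 0 < A / 2) (by linarith) hz)
    (memLp_one_iff_integrable.1 (memLp_of_ae_bound_of_support hm hs hb 1))
    (memLp_of_ae_bound_of_support hm hs hb 2)).trans
    (mul_le_mul_right (eLpNorm_two_atom_le hr hs hb) _)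
  rw [← ENNReal.ofReal_mul (by positivity)] at hL
  refine (setLIntegral_enorm_le_of_eLpNorm_two (V := 8 * A) (aestronglyMeasurable_conv
    (hcont.measurable.indicator hS) hm.aestronglyMeasurable) ?_ hL).trans
    (ENNReal.ofReal_le_ofReal ?_)
  · have : {x : ℝ | A ≤ |x| ∧ |x| ≤ 4 * A} ⊆ Set.Icc (-(4 * A)) (4 * A) := fun x hx =>
      abs_le.1 hx.2
    refine (measure_mono this).trans ?_
    rw [Real.volume_Icc]
    exact ENNReal.ofReal_le_ofReal (by linarith)
  · rw [abs_one, one_mul]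
    obtain ⟨m, rfl⟩ : ∃ m, n = m + 2 := ⟨n - 2, by lia⟩
    simp only [Nat.add_sub_cancel, show m + 2 - 1 = m + 1 by lia]
    have hq : 0 < √((A / 2) ^ m) := Real.sqrt_pos.2 (by positivity)
    have hq2 : 0 < √(2 * r) := Real.sqrt_pos.2 (by positivity)
    have hq3 : 0 < √(A ^ (m + 1) * r) := Real.sqrt_pos.2 (by positivity)
    have key : √(8 * A) / (√((A / 2) ^ m) * (A / 2) * √(2 * r)) ≤
        2 * 2 ^ (m + 2) * (√(A ^ (m + 1) * r))⁻¹ := by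
      rw [← pow_le_pow_iff_left₀ (by positivity) (by positivity) two_ne_zero]
      rw [div_pow, mul_pow, mul_pow, mul_pow, inv_pow, Real.sq_sqrt (by positivity),
        Real.sq_sqrt (by positivity), Real.sq_sqrt (by positivity), Real.sq_sqrt (by positivity)]
      have h2 : (1 : ℝ) ≤ 2 ^ (m + 2) := one_le_pow₀ (by norm_num)
      have e : 8 * A / ((A / 2) ^ m * (A / 2) ^ 2 * (2 * r)) =
          2 ^ 2 * 2 ^ (m + 2) * (A ^ (m + 1) * r)⁻¹ := by
        rw [div_pow, div_pow]
        field_simp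
        ring
      rw [e, mul_pow]
      gcongr
      nlinarith
    calc _ ≤ √(8 * A) * (24 * (1 + |z.im|) / (√((A / 2) ^ m) * (A / 2)) * (√(2 * r))⁻¹) := by
          gcongr
          linarith
      _ = 24 * (1 + |z.im|) * (√(8 * A) / (√((A / 2) ^ m) * (A / 2) * √(2 * r))) := by
          field_simp
      _ ≤ 24 * (1 + |z.im|) * (2 * 2 ^ (m + 2) * (√(A ^ (m + 1) * r))⁻¹) := by gcongr
      _ = _ := by ring

/-- Summing over the annuli `4^j R ≤ |x| ≤ 4^{j+1} R`: the bounds decay like `2^{-j}` once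
`R^{n-1} r ≥ 1`. -/
theorem setLIntegral_far_le {n : ℕ} (hn : 2 ≤ n) {z : ℂ} (hz : z.re = -1) {a : ℝ → ℂ} {r : ℝ}
    (hr : 0 < r) (hm : Measurable a) (hs : Function.support a ⊆ Set.Icc (-r) r)
    (hb : ∀ᵐ x, ‖a x‖ ≤ (2 * r)⁻¹) {R : ℝ} (hR : 4 * r ≤ R) (hRr : 1 ≤ R ^ (n - 1) * r) :
    ∫⁻ x in {x : ℝ | R ≤ |x|}, ‖∫ y, oscKernel n 1 1 z (x - y) * a y‖ₑ
      ≤ ENNReal.ofReal (96 * 2 ^ n * (1 + |z.im|)) := by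
  have hR0 : 0 < R := by linarith
  have h0 : 0 ≤ 1 + |z.im| := by positivity
  have hcover : {x : ℝ | R ≤ |x|} ⊆
      ⋃ j : ℕ, {x : ℝ | 4 ^ j * R ≤ |x| ∧ |x| ≤ 4 * (4 ^ j * R)} := by
    intro x hx
    obtain ⟨j, h1, h2⟩ := exists_nat_pow_near (x := |x| / R) (y := (4 : ℝ))
      ((one_le_div hR0).2 hx) (by norm_num)
    rw [le_div_iff₀ hR0] at h1
    rw [div_lt_iff₀ hR0, pow_succ] at h2
    exact Set.mem_iUnion.2 ⟨j, h1, by linarith⟩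
  refine (lintegral_mono_set hcover).trans ((lintegral_iUnion_le _ _).trans ?_)
  have hterm : ∀ j : ℕ, ∫⁻ x in {x : ℝ | 4 ^ j * R ≤ |x| ∧ |x| ≤ 4 * (4 ^ j * R)},
      ‖∫ y, oscKernel n 1 1 z (x - y) * a y‖ₑ
      ≤ ENNReal.ofReal (48 * 2 ^ n * (1 + |z.im|) * (1 / 2) ^ j) := by
    intro j
    have h4 : (1 : ℝ) ≤ 4 ^ j := one_le_pow₀ (by norm_num)
    refine (setLIntegral_annulus_le hn hz hr hm hs hb (hR.trans (by nlinarith))).trans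
      (ENNReal.ofReal_le_ofReal ?_)
    refine mul_le_mul_of_nonneg_left ?_ (by positivity)
    rw [one_div, inv_pow]
    refine inv_anti₀ (by positivity) (Real.le_sqrt_of_sq_le ?_)
    have h5 : (4 : ℝ) ^ j ≤ (4 ^ j) ^ (n - 1) := le_self_pow₀ h4 (by lia)
    calc ((2 : ℝ) ^ j) ^ 2 = 4 ^ j * 1 := by rw [← pow_mul, mul_comm j, pow_mul]; norm_num
      _ ≤ (4 ^ j) ^ (n - 1) * (R ^ (n - 1) * r) := by gcongr
      _ = _ := by rw [mul_pow]; ring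
  refine (ENNReal.tsum_le_tsum hterm).trans (le_of_eq ?_)
  have hsum := summable_geometric_two.mul_left (48 * 2 ^ n * (1 + |z.im|))
  rw [← ENNReal.ofReal_tsum_of_nonneg (fun j => by positivity) hsum, tsum_mul_left,
    tsum_geometric_two]
  congr 1
  ring

theorem hasDerivAt_oscKernel {n : ℕ} {z : ℂ} (hz : z.re = -1) {t : ℝ} (ht : t ≠ 0) :
    HasDerivAt (oscKernel n 1 1 z)
      (Complex.exp (Complex.I * ((1 * t ^ n : ℝ) : ℂ)) * (Complex.I * ((n * t ^ (n - 1) : ℝ) : ℂ)) *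
          ((1 + |t| : ℝ) : ℂ) ^ z +
        Complex.exp (Complex.I * ((1 * t ^ n : ℝ) : ℂ)) *
          ((SignType.sign t : ℝ) • (z * ((1 + |t| : ℝ) : ℂ) ^ (z - 1)))) t := by
  have h1 : HasDerivAt (fun t : ℝ => Complex.exp (Complex.I * ((1 * t ^ n : ℝ) : ℂ)))
      (Complex.exp (Complex.I * ((1 * t ^ n : ℝ) : ℂ)) *
        (Complex.I * ((n * t ^ (n - 1) : ℝ) : ℂ))) t := by
    have hp : HasDerivAt (fun t : ℝ => 1 * t ^ n) (n * t ^ (n - 1)) t := by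
      simpa using hasDerivAt_pow n t
    exact (hp.ofReal_comp.const_mul Complex.I).cexp
  have h2 := (hasDerivAt_shift_cpow hz (δ := 1) (t := |t|) (by positivity)).scomp t
    (hasDerivAt_abs ht)
  exact h1.mul h2

theorem norm_deriv_oscKernel_le {n : ℕ} (hn : 2 ≤ n) {z : ℂ} (hz : z.re = -1) {t : ℝ}
    (ht : t ≠ 0) :
    ‖deriv (oscKernel n 1 1 z) t‖ ≤ n * |t| ^ (n - 2) + ‖z‖ / t ^ 2 := by
  have ht' : 0 < |t| := abs_pos.2 ht
  have h1 : 0 < 1 + |t| := by positivity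
  rw [(hasDerivAt_oscKernel hz ht).deriv]
  refine (norm_add_le _ _).trans (add_le_add ?_ ?_)
  · rw [norm_mul, norm_mul, norm_exp_I_mul_ofReal, one_mul, norm_mul, Complex.norm_I, one_mul,
      norm_ofReal_cpow_of_re_eq hz h1, Complex.norm_real, Real.norm_eq_abs, abs_mul, abs_pow,
      Nat.abs_cast, mul_assoc]
    refine mul_le_mul_of_nonneg_left ?_ (by positivity)
    rw [show n - 1 = n - 2 + 1 by lia, pow_succ, mul_assoc]
    refine mul_le_of_le_one_right (by positivity) ?_
    rw [← div_eq_mul_inv, div_le_one h1]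
    linarith
  · rw [norm_mul, norm_exp_I_mul_ofReal, one_mul, norm_smul, norm_shift_cpow_deriv hz h1,
      ← sq_abs t]
    have hsg : ‖((SignType.sign t : SignType) : ℝ)‖ ≤ 1 := by
      rcases lt_or_gt_of_ne ht with h | h
      · simp [sign_neg h]
      · simp [sign_pos h]
    refine (mul_le_of_le_one_left (by positivity) hsg).trans ?_
    gcongr
    linarith

/-- Away from the support the vanishing integral of the atom lets one subtract `k(x)` from the
kernel. -/
theorem norm_conv_atom_le_of_cancellation {n : ℕ} (hn : 2 ≤ n) {z : ℂ} (hz : z.re = -1)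
    {a : ℝ → ℂ} {r : ℝ} (hr : 0 < r) (hm : Measurable a)
    (hs : Function.support a ⊆ Set.Icc (-r) r) (hb : ∀ᵐ x, ‖a x‖ ≤ (2 * r)⁻¹)
    (h0 : ∫ y, a y = 0) {x R : ℝ} (hx : 4 * r ≤ |x|) (hxR : |x| ≤ R) :
    ‖∫ y, oscKernel n 1 1 z (x - y) * a y‖ ≤ r * (n * (2 * R) ^ (n - 2) + 4 * ‖z‖ / x ^ 2) := by
  have hx0 : 0 < |x| := by linarith
  have hR : 0 ≤ R := hx0.le.trans hxR
  have hi := memLp_one_iff_integrable.1 (memLp_of_ae_bound_of_support hm hs hb 1)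
  have hi2 := integrable_conv_of_memLp_two (memLp_oscKernel (n := n) (l := 1) one_pos hz)
    (memLp_of_ae_bound_of_support hm hs hb 2) x
  set D := n * (2 * R) ^ (n - 2) + 4 * ‖z‖ / x ^ 2 with hD
  have hD0 : 0 ≤ D := by positivity
  have hdiff : ∀ y ∈ Set.Icc (-r) r, ‖oscKernel n 1 1 z (x - y) - oscKernel n 1 1 z x‖ ≤ r * D := by
    intro y hy
    have hy' := abs_le.2 hy
    have hseg : ∀ t ∈ Set.uIcc x (x - y), |x| / 2 ≤ |t| ∧ |t| ≤ 2 * R := by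
      intro t ht
      have h1 : |t - x| ≤ |x - y - x| := Set.abs_sub_left_of_mem_uIcc ht
      rw [show x - y - x = -y by ring, abs_neg] at h1
      have h2 := abs_sub_abs_le_abs_sub x t
      have h3 := abs_sub_abs_le_abs_sub t x
      rw [abs_sub_comm] at h2
      constructor <;> linarith
    have hne : ∀ t ∈ Set.uIcc x (x - y), t ≠ 0 := fun t ht =>
      abs_pos.1 (lt_of_lt_of_le (by positivity) (hseg t ht).1)
    have hmv := Convex.norm_image_sub_le_of_norm_deriv_le (𝕜 := ℝ) (f := oscKernel n 1 1 z) (C := D)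
      (fun t ht => (hasDerivAt_oscKernel hz (hne t ht)).differentiableAt) (fun t ht => ?_)
      (convex_uIcc x (x - y)) Set.left_mem_uIcc Set.right_mem_uIcc
    · refine hmv.trans ?_
      rw [show x - y - x = -y by ring, norm_neg, Real.norm_eq_abs, mul_comm]
      gcongr
    · refine (norm_deriv_oscKernel_le hn hz (hne t ht)).trans (add_le_add ?_ ?_)
      · gcongr
        exact (hseg t ht).2
      · have : x ^ 2 / 4 ≤ t ^ 2 := by
          rw [← sq_abs x, ← sq_abs t]
          nlinarith [(hseg t ht).1]
        have hx2 : 0 < x ^ 2 := by rw [← sq_abs]; positivity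
        rw [div_le_div_iff₀ (by linarith) hx2]
        nlinarith [norm_nonneg z]
  have hsub : ∫ y, oscKernel n 1 1 z (x - y) * a y =
      ∫ y, (oscKernel n 1 1 z (x - y) - oscKernel n 1 1 z x) * a y := by
    simp_rw [sub_mul]
    rw [integral_sub hi2 (hi.const_mul _), integral_const_mul, h0, mul_zero, sub_zero]
  rw [hsub]
  calc _ ≤ ∫ y, r * D * ‖a y‖ := by
        refine norm_integral_le_of_norm_le (hi.norm.const_mul _) (ae_of_all _ fun y => ?_)
        rw [norm_mul]
        by_cases hy : a y = 0
        · simp [hy]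
        · exact mul_le_mul_of_nonneg_right (hdiff y (hs hy)) (norm_nonneg _)
    _ = r * D * ∫ y, ‖a y‖ := integral_const_mul _ _
    _ ≤ r * D := mul_le_of_le_one_right (by positivity) (integral_norm_atom_le hr hm hs hb)

/-- The intermediate region `4 r ≤ |x| ≤ R`, where `R^{n-1} r` is bounded. -/
theorem setLIntegral_middle_le {n : ℕ} (hn : 2 ≤ n) {z : ℂ} (hz : z.re = -1)
    {a : ℝ → ℂ} {r : ℝ} (hr : 0 < r) (hm : Measurable a)
    (hs : Function.support a ⊆ Set.Icc (-r) r) (hb : ∀ᵐ x, ‖a x‖ ≤ (2 * r)⁻¹)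
    (h0 : ∫ y, a y = 0) {R : ℝ} (hR : 4 * r ≤ R) (hRr : R ^ (n - 1) * r = 4 ^ (n - 1)) :
    ∫⁻ x in {x : ℝ | 4 * r ≤ |x| ∧ |x| ≤ R}, ‖∫ y, oscKernel n 1 1 z (x - y) * a y‖ₑ
      ≤ ENNReal.ofReal ((n * 8 ^ n + 2) * (1 + |z.im|)) := by
  have hr4 : 0 < 4 * r := by positivity
  have hR0 : 0 < R := by linarith
  set h : ℝ → ℝ := fun x => r * (n * (2 * R) ^ (n - 2) + 4 * ‖z‖ / x ^ 2) with hh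
  have hhpos : ∀ x, 0 ≤ h x := fun x => by positivity
  have hne : ∀ x ∈ Set.Icc (4 * r) R, x ≠ 0 := fun x hx => (hr4.trans_le hx.1).ne'
  have hcont : ContinuousOn h (Set.Icc (4 * r) R) := by
    refine continuousOn_const.mul (continuousOn_const.add (continuousOn_const.div (by fun_prop) ?_))
    exact fun x hx => pow_ne_zero 2 (hne x hx)
  have hval : ∫ x in Set.Icc (4 * r) R, h x ≤ r * n * (2 * R) ^ (n - 2) * R + ‖z‖ := by
    have hu := Set.uIcc_of_le hR
    have hd : ∀ x ∈ Set.uIcc (4 * r) R, HasDerivAt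
        (fun x : ℝ => r * n * (2 * R) ^ (n - 2) * x - 4 * r * ‖z‖ * x⁻¹) (h x) x := by
      intro x hx
      rw [hu] at hx
      refine (((hasDerivAt_id x).const_mul (r * n * (2 * R) ^ (n - 2))).sub
        ((hasDerivAt_inv (hne x hx)).const_mul (4 * r * ‖z‖))).congr_deriv ?_
      simp only [hh]
      ring
    rw [integral_Icc_eq_integral_Ioc, ← intervalIntegral.integral_of_le hR,
      intervalIntegral.integral_eq_sub_of_hasDerivAt hd
        (ContinuousOn.intervalIntegrable (by rwa [hu]))]
    have e1 : 4 * r * ‖z‖ * (4 * r)⁻¹ = ‖z‖ := by field_simp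
    have e2 : 0 ≤ 4 * r * ‖z‖ * R⁻¹ := by positivity
    have e3 : 0 ≤ r * n * (2 * R) ^ (n - 2) * (4 * r) := by positivity
    rw [e1]
    linarith
  have hconst : r * n * (2 * R) ^ (n - 2) * R ≤ n * 8 ^ n / 2 := by
    obtain ⟨m, rfl⟩ : ∃ m, n = m + 2 := ⟨n - 2, by lia⟩
    simp only [Nat.add_sub_cancel, show m + 2 - 1 = m + 1 by lia] at hRr ⊢
    have e : r * ((m + 2 : ℕ) : ℝ) * (2 * R) ^ m * R =
        ((m + 2 : ℕ) : ℝ) * (2 ^ m * (R ^ (m + 1) * r)) := by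
      rw [mul_pow]; ring
    rw [e, hRr, mul_div_assoc]
    refine mul_le_mul_of_nonneg_left ?_ (by positivity)
    have e8 : (2 : ℝ) ^ m * 4 ^ m = 8 ^ m := by rw [← mul_pow]; norm_num
    have : (0 : ℝ) ≤ 8 ^ m := by positivity
    rw [pow_succ 4, ← mul_assoc, e8, pow_add]
    linarith
  have hpiece : ∫⁻ x in Set.Icc (4 * r) R, ENNReal.ofReal (h x)
      ≤ ENNReal.ofReal (n * 8 ^ n / 2 + ‖z‖) := by
    rw [← ofReal_integral_eq_lintegral_ofReal hcont.integrableOn_Icc (ae_of_all _ hhpos)]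
    exact ENNReal.ofReal_le_ofReal (hval.trans (by linarith))
  have hpiece' : ∫⁻ x in Set.Icc (-R) (-(4 * r)), ENNReal.ofReal (h x)
      ≤ ENNReal.ofReal (n * 8 ^ n / 2 + ‖z‖) := by
    have e := (Measure.measurePreserving_neg (volume : Measure ℝ)).setLIntegral_comp_preimage_emb
      (Homeomorph.neg ℝ).measurableEmbedding (fun x => ENNReal.ofReal (h x))
      (Set.Icc (-R) (-(4 * r)))
    have hpre : Neg.neg ⁻¹' Set.Icc (-R) (-(4 * r)) = Set.Icc (4 * r) R := by
      simp
    rw [hpre] at e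
    rw [← e]
    simpa [hh] using hpiece
  have hz1 := norm_le_one_add_abs_im hz
  calc _ ≤ ∫⁻ x in {x : ℝ | 4 * r ≤ |x| ∧ |x| ≤ R}, ENNReal.ofReal (h x) := by
        refine setLIntegral_mono' (measurableSet_setOf_le_abs_le _ _) fun x hx => ?_
        rw [← ofReal_norm]
        exact ENNReal.ofReal_le_ofReal
          (norm_conv_atom_le_of_cancellation hn hz hr hm hs hb h0 hx.1 hx.2)
    _ ≤ ENNReal.ofReal (n * 8 ^ n / 2 + ‖z‖) + ENNReal.ofReal (n * 8 ^ n / 2 + ‖z‖) := by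
        rw [setOf_le_abs_le_eq_union hr4]
        exact (lintegral_union_le _ _ _).trans (add_le_add hpiece hpiece')
    _ = ENNReal.ofReal (n * 8 ^ n + 2 * ‖z‖) := by
        rw [← ENNReal.ofReal_add (by positivity) (by positivity)]
        congr 1
        ring
    _ ≤ _ := by
        refine ENNReal.ofReal_le_ofReal ?_
        have : (0 : ℝ) ≤ n * 8 ^ n * |z.im| := by positivity
        nlinarith

/-- A constant, depending only on `n`, for the `L¹` norm of the image of an atom. -/
noncomputable def atomConst (n : ℕ) : ℝ := 30 + n * 8 ^ n + 96 * 2 ^ n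

/-- The image of an atom centred at the origin. The crossover radius `R ∼ r^{-1/(n-1)}` between
cancellation and oscillation exceeds the support of the atom only if `r < 1`; for `r ≥ 1` the
vanishing integral is not needed. -/
theorem lintegral_conv_centred_atom_le {n : ℕ} (hn : 2 ≤ n) {z : ℂ} (hz : z.re = -1)
    {a : ℝ → ℂ} {r : ℝ} (hr : 0 < r) (hm : Measurable a)
    (hs : Function.support a ⊆ Set.Icc (-r) r) (hb : ∀ᵐ x, ‖a x‖ ≤ (2 * r)⁻¹)
    (h0 : ∫ y, a y = 0) :
    ∫⁻ x, ‖∫ y, oscKernel n 1 1 z (x - y) * a y‖ₑ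
      ≤ ENNReal.ofReal (atomConst n * (1 + |z.im|)) := by
  have hτ : 0 ≤ 1 + |z.im| := by positivity
  have h4 : (1 : ℝ) ≤ 4 ^ (n - 1) := one_le_pow₀ (by norm_num)
  have near := setLIntegral_near_le hn hz hr hm hs hb
  rcases le_or_gt 1 r with hr1 | hr1
  · have far := setLIntegral_far_le hn hz hr hm hs hb le_rfl (by
      have : (1 : ℝ) ≤ (4 * r) ^ (n - 1) := one_le_pow₀ (by linarith)
      nlinarith)
    have hcov : {x : ℝ | |x| ≤ 4 * r} ∪ {x : ℝ | 4 * r ≤ |x|} = Set.univ :=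
      Set.eq_univ_of_forall fun x => (le_total |x| (4 * r)).elim Or.inl Or.inr
    rw [← setLIntegral_univ, ← hcov]
    refine (lintegral_union_le _ _ _).trans ((add_le_add near far).trans ?_)
    rw [← ENNReal.ofReal_add (by positivity) (by positivity)]
    refine ENNReal.ofReal_le_ofReal ?_
    rw [atomConst, ← add_mul]
    gcongr
    have : (0 : ℝ) ≤ n * 8 ^ n := by positivity
    linarith
  · have hn1 : ((n - 1 : ℕ) : ℝ) ≠ 0 := by exact_mod_cast (by lia : n - 1 ≠ 0)
    set R : ℝ := 4 * r ^ (-(((n - 1 : ℕ) : ℝ)⁻¹)) with hRdef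
    have hR : 4 * r ≤ R := by
      have : (1 : ℝ) ≤ r ^ (-(((n - 1 : ℕ) : ℝ)⁻¹)) :=
        Real.one_le_rpow_of_pos_of_le_one_of_nonpos hr hr1.le
          (neg_nonpos.2 (by positivity))
      linarith
    have hRr : R ^ (n - 1) * r = 4 ^ (n - 1) := by
      rw [hRdef, mul_pow, ← Real.rpow_natCast (r ^ _), ← Real.rpow_mul hr.le, neg_mul,
        inv_mul_cancel₀ hn1, Real.rpow_neg_one, mul_assoc, inv_mul_cancel₀ hr.ne', mul_one]
    have mid := setLIntegral_middle_le hn hz hr hm hs hb h0 hR hRr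
    have far := setLIntegral_far_le hn hz hr hm hs hb hR (by rw [hRr]; exact h4)
    have hcov : {x : ℝ | |x| ≤ 4 * r} ∪
        ({x : ℝ | 4 * r ≤ |x| ∧ |x| ≤ R} ∪ {x : ℝ | R ≤ |x|}) = Set.univ := by
      refine Set.eq_univ_of_forall fun x => ?_
      rcases le_total |x| (4 * r) with h | h
      · exact Or.inl h
      · rcases le_total |x| R with h' | h'
        · exact Or.inr (Or.inl ⟨h, h'⟩)
        · exact Or.inr (Or.inr h')
    rw [← setLIntegral_univ, ← hcov]
    refine (lintegral_union_le _ _ _).trans ((add_le_add near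
      ((lintegral_union_le _ _ _).trans (add_le_add mid far))).trans ?_)
    rw [← ENNReal.ofReal_add (by positivity) (by positivity),
      ← ENNReal.ofReal_add (by positivity) (by positivity)]
    refine ENNReal.ofReal_le_ofReal (le_of_eq ?_)
    rw [atomConst]
    ring

/-- The image of an atom under convolution with the kernel is bounded in `L¹`: by translation
invariance the atom may be centred at the origin. -/
theorem lintegral_conv_atom_le {n : ℕ} (hn : 2 ≤ n) {z : ℂ} (hz : z.re = -1)
    {a : ℝ → ℂ} (ha : IsH1Atom a) :
    ∫⁻ x, ‖∫ y, oscKernel n 1 1 z (x - y) * a y‖ₑ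
      ≤ ENNReal.ofReal (atomConst n * (1 + |z.im|)) := by
  obtain ⟨hm, ⟨c, r, hr, hs, hb⟩, h0⟩ := ha
  have key := lintegral_conv_centred_atom_le hn hz hr (a := fun y => a (y + c))
    (hm.comp (measurable_add_const c))
    (fun y hy => by
      have := hs (show y + c ∈ Function.support a from hy)
      exact ⟨by linarith [this.1], by linarith [this.2]⟩)
    ((measurePreserving_add_right volume c).quasiMeasurePreserving.ae hb)
    (by rw [integral_add_right_eq_self a c, h0])
  refine le_trans (le_of_eq ?_) key
  rw [← lintegral_add_right_eq_self _ c]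
  refine lintegral_congr fun x => ?_
  rw [← integral_add_right_eq_self _ c]
  simp only [add_sub_add_right_eq_sub]

/-! ### From atoms to the Hardy space -/

theorem integrable_conv_of_bounded {k g : ℝ → ℂ} {c : ℝ} (hk : Measurable k) (hc : ∀ t, ‖k t‖ ≤ c)
    (hg : Integrable g) (x : ℝ) : Integrable fun y => k (x - y) * g y :=
  hg.bdd_mul (c := c) (hk.comp (measurable_const.sub measurable_id)).aestronglyMeasurable
    (ae_of_all _ fun _ => hc _)

theorem IsH1Atom.integrable {a : ℝ → ℂ} (ha : IsH1Atom a) : Integrable a := by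
  obtain ⟨hm, ⟨c, r, hr, hs, hb⟩, -⟩ := ha
  have h1 : IntegrableOn a (Set.Icc (c - r) (c + r)) :=
    Measure.integrableOn_of_bounded (by simp) hm.aestronglyMeasurable (ae_restrict_of_ae hb)
  exact (integrableOn_iff_integrable_of_support_subset hs).1 h1

/-- Since the kernel is bounded, `L¹` convergence of an atomic decomposition `f = ∑ μⱼ aⱼ` yields
pointwise control of the image of `f` by the images of the atoms. -/
theorem enorm_conv_le_tsum {k : ℝ → ℂ} (hk : Measurable k) (hk1 : ∀ t, ‖k t‖ ≤ 1) {f : ℝ → ℂ}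
    (hf : Integrable f) {μ : ℕ → ℂ} {a : ℕ → ℝ → ℂ} (hd : IsAtomicDecomposition f μ a) (x : ℝ) :
    ‖∫ y, k (x - y) * f y‖ₑ ≤ ∑' j, ‖μ j‖ₑ * ‖∫ y, k (x - y) * a j y‖ₑ := by
  obtain ⟨ha, -, hlim⟩ := hd
  have hlim' := hlim.add (tendsto_const_nhds
    (x := ∑' j, ‖μ j‖ₑ * ‖∫ y, k (x - y) * a j y‖ₑ))
  rw [zero_add] at hlim'
  refine ge_of_tendsto hlim' (Eventually.of_forall fun N => ?_)
  have hai : ∀ j, Integrable fun y => k (x - y) * a j y := fun j =>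
    integrable_conv_of_bounded hk hk1 (ha j).integrable x
  have hS : Integrable fun y => ∑ j ∈ Finset.range N, μ j * a j y :=
    integrable_finsetSum _ fun j _ => (ha j).integrable.const_mul _
  have hsum : ∫ y, k (x - y) * f y =
      (∫ y, k (x - y) * (f y - ∑ j ∈ Finset.range N, μ j * a j y)) +
        ∑ j ∈ Finset.range N, μ j * ∫ y, k (x - y) * a j y := by
    have hd : Integrable fun y => k (x - y) * (f y - ∑ j ∈ Finset.range N, μ j * a j y) :=
      integrable_conv_of_bounded hk hk1 (hf.sub hS) x
    simp_rw [← integral_const_mul]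
    rw [← integral_finsetSum _ fun j _ => (hai j).const_mul _,
      ← integral_add hd (integrable_finsetSum _ fun j _ => (hai j).const_mul _)]
    refine integral_congr_ae (ae_of_all _ fun y => ?_)
    have e : ∑ j ∈ Finset.range N, μ j * (k (x - y) * a j y) =
        k (x - y) * ∑ j ∈ Finset.range N, μ j * a j y := by
      rw [Finset.mul_sum]
      exact Finset.sum_congr rfl fun j _ => by ring
    simp only
    rw [e]
    ring
  rw [hsum]
  refine (enorm_add_le _ _).trans (add_le_add ?_ ?_)
  · rw [eLpNorm_one_eq_lintegral_enorm]
    refine (enorm_integral_le_lintegral_enorm _).trans (lintegral_mono fun y => ?_)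
    rw [enorm_mul]
    refine mul_le_of_le_one_left' ?_
    rw [← ofReal_norm]
    exact ENNReal.ofReal_le_one.2 (hk1 _)
  · refine (enorm_sum_le _ _).trans ?_
    simp_rw [enorm_mul]
    exact ENNReal.sum_le_tsum _

theorem eLpNorm_one_conv_le_h1Norm {n : ℕ} (hn : 2 ≤ n) {z : ℂ} (hz : z.re = -1)
    {f : ℝ → ℂ} (hf : Integrable f) :
    eLpNorm (fun x => ∫ y, oscKernel n 1 1 z (x - y) * f y) 1 volume
      ≤ ENNReal.ofReal (atomConst n * (1 + |z.im|)) * h1Norm f := by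
  have hkm := (continuous_oscKernel (n := n) (l := 1) (z := z) one_pos).measurable
  have hk1 : ∀ t, ‖oscKernel n 1 1 z t‖ ≤ 1 := fun t => by
    rw [norm_oscKernel one_pos hz]
    exact inv_le_one_of_one_le₀ (by linarith [abs_nonneg t])
  have hne : ENNReal.ofReal (atomConst n * (1 + |z.im|)) ≠ 0 := by
    rw [Ne, ENNReal.ofReal_eq_zero, not_le, atomConst]
    positivity
  unfold h1Norm
  simp only [ENNReal.mul_iInf_of_ne hne ENNReal.ofReal_ne_top]
  refine le_iInf fun μ => le_iInf fun a => le_iInf fun hd => ?_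
  rw [eLpNorm_one_eq_lintegral_enorm]
  calc _ ≤ ∫⁻ x, ∑' j, ‖μ j‖ₑ * ‖∫ y, oscKernel n 1 1 z (x - y) * a j y‖ₑ :=
        lintegral_mono fun x => enorm_conv_le_tsum hkm hk1 hf hd x
    _ = ∑' j, ‖μ j‖ₑ * ∫⁻ x, ‖∫ y, oscKernel n 1 1 z (x - y) * a j y‖ₑ := by
        have hmeas : ∀ j, AEMeasurable fun x => ‖∫ y, oscKernel n 1 1 z (x - y) * a j y‖ₑ :=
          fun j => (aestronglyMeasurable_conv hkm
            (hd.1 j).1.aestronglyMeasurable).enorm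
        rw [lintegral_tsum fun j => (hmeas j).const_mul _]
        exact tsum_congr fun j => lintegral_const_mul'' _ (hmeas j)
    _ ≤ ∑' j, ‖μ j‖ₑ * ENNReal.ofReal (atomConst n * (1 + |z.im|)) :=
        ENNReal.tsum_le_tsum fun j => mul_le_mul_right (lintegral_conv_atom_le hn hz (hd.1 j)) _
    _ = _ := by rw [ENNReal.tsum_mul_right, mul_comm]

theorem h1Norm_ne_top {f : ℝ → ℂ} (hf : MemH1 f) : h1Norm f ≠ ⊤ := by
  obtain ⟨-, μ, a, hd⟩ := hf
  refine ne_top_of_le_ne_top ?_ ((iInf_le _ μ).trans ((iInf_le _ a).trans (iInf_le _ hd)))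
  have := hd.2.1.tsum_ofReal_ne_top
  simpa only [ofReal_norm] using this

/-! ### Smooth cutoffs -/

theorem eLpNorm_two_sq {α : Type*} [MeasurableSpace α] (ν : Measure α) (g : α → ℂ) :
    eLpNorm g 2 ν ^ 2 = ∫⁻ x, ‖g x‖ₑ ^ 2 ∂ν := by
  have := eLpNorm_nnreal_pow_eq_lintegral (f := g) (μ := ν) (p := 2) two_ne_zero
  simpa using! this

theorem sq_setLIntegral_le {g : ℝ → ℂ} (hg : AEStronglyMeasurable g) (S : Set ℝ) :
    (∫⁻ s in S, ‖g s‖ₑ) ^ 2 ≤ volume S * ∫⁻ s in S, ‖g s‖ₑ ^ 2 := by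
  have h := eLpNorm_le_eLpNorm_mul_rpow_measure_univ (μ := volume.restrict S) (p := 1) (q := 2)
    (by norm_num) hg.restrict
  rw [eLpNorm_one_eq_lintegral_enorm, Measure.restrict_apply_univ] at h
  refine (pow_le_pow_left' h 2).trans (le_of_eq ?_)
  rw [mul_pow, eLpNorm_two_sq, mul_comm, ← ENNReal.rpow_natCast, ← ENNReal.rpow_mul]
  norm_num

/-- Inserting an amplitude `φ(x, y) = ∫_{-R}^R 1_{s < y} ψ(x, s) ds` into a convolution operator:
the new operator is the average over `s` of `ψ(x, s)` times the old one applied to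
`f 1_{(s, ∞)}`, and truncation of `f` does not increase its norm. -/
theorem eLpNorm_conv_amplitude_le {k : ℝ → ℂ} (hkm : Measurable k) (hk : MemLp k 2) {M : ℝ≥0∞}
    (hM : ∀ g : ℝ → ℂ, MemLp g 2 →
      eLpNorm (fun x => ∫ y, k (x - y) * g y) 2 volume ≤ M * eLpNorm g 2 volume)
    {φ ψ : ℝ × ℝ → ℂ} (hψ : Continuous ψ) {B R : ℝ} (hB : ∀ p, ‖ψ p‖ ≤ B)
    (hφ : ∀ x y, φ (x, y) = ∫ s in Set.Icc (-R) R, (Set.Iio y).indicator (fun s => ψ (x, s)) s)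
    {f : ℝ → ℂ} (hf : MemLp f 2) :
    eLpNorm (fun x => ∫ y, k (x - y) * φ (x, y) * f y) 2 volume
      ≤ ENNReal.ofReal (B * (2 * R)) * M * eLpNorm f 2 volume := by
  have hB0 : 0 ≤ B := (norm_nonneg _).trans (hB 0)
  -- strict measurability of `f` makes the auxiliary function `G` below jointly measurable
  wlog hfm : StronglyMeasurable f generalizing f
  · have hae := hf.aestronglyMeasurable.ae_eq_mk
    have key := this ((memLp_congr_ae hae).1 hf) hf.aestronglyMeasurable.stronglyMeasurable_mk
    rw [eLpNorm_congr_ae hae]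
    refine le_trans (le_of_eq ?_) key
    congr 1
    ext x
    refine integral_congr_ae ?_
    filter_upwards [hae] with y hy
    rw [hy]
  set I : Set ℝ := Set.Icc (-R) R with hI
  have hIvol : volume I = ENNReal.ofReal (2 * R) := by
    rw [hI, Real.volume_Icc]; congr 1; ring
  set G : ℝ → ℝ → ℂ := fun x s => ∫ y, k (x - y) * (Set.Ioi s).indicator f y with hG
  have hlt : MeasurableSet {p : (ℝ × ℝ) × ℝ | p.1.2 < p.2} :=
    measurableSet_lt (measurable_snd.comp measurable_fst) measurable_snd
  have hGm : StronglyMeasurable (Function.uncurry G) := by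
    refine StronglyMeasurable.integral_prod_right' (f := fun p : (ℝ × ℝ) × ℝ =>
      k (p.1.1 - p.2) * (Set.Ioi p.1.2).indicator f p.2) ?_
    refine (hkm.comp ((measurable_fst.comp measurable_fst).sub
      measurable_snd)).stronglyMeasurable.mul ?_
    exact (hfm.comp_measurable measurable_snd).indicator hlt
  have hGm' : ∀ x, AEStronglyMeasurable (G x) := fun x =>
    (hGm.comp_measurable measurable_prodMk_left).aestronglyMeasurable
  have hrep : ∀ x, ∫ y, k (x - y) * φ (x, y) * f y = ∫ s in I, ψ (x, s) * G x s := by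
    intro x
    have hkf := integrable_conv_of_memLp_two hk hf x
    have hjoint : Integrable (Function.uncurry fun y s => k (x - y) *
        (Set.Iio y).indicator (fun s => ψ (x, s)) s * f y) (volume.prod (volume.restrict I)) := by
      refine Integrable.mono'
        (hkf.norm.mul_prod (integrable_const (μ := volume.restrict I) B)) ?_ ?_
      · refine AEStronglyMeasurable.mul (AEStronglyMeasurable.mul ?_ ?_) ?_
        · exact (hkm.comp (measurable_const.sub measurable_fst)).aestronglyMeasurable
        · have hlt' : MeasurableSet {p : ℝ × ℝ | p.2 < p.1} :=
            measurableSet_lt measurable_snd measurable_fst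
          have hc : Measurable fun p : ℝ × ℝ => ψ (x, p.2) :=
            hψ.measurable.comp (measurable_const.prodMk measurable_snd)
          exact (hc.indicator hlt').aestronglyMeasurable
        · exact (hfm.comp_measurable measurable_fst).aestronglyMeasurable
      · refine ae_of_all _ fun p => ?_
        have h1 : ‖(Set.Iio p.1).indicator (fun s => ψ (x, s)) p.2‖ ≤ B :=
          (norm_indicator_le_norm_self _ _).trans (hB _)
        simp only [Function.uncurry, norm_mul]
        calc _ ≤ ‖k (x - p.1)‖ * B * ‖f p.1‖ := by gcongr
          _ = _ := by ring
    calc _ = ∫ y, ∫ s in I, k (x - y) * (Set.Iio y).indicator (fun s => ψ (x, s)) s * f y := by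
          refine integral_congr_ae (ae_of_all _ fun y => ?_)
          simp only
          rw [integral_mul_const, integral_const_mul, hφ]
      _ = ∫ s in I, ∫ y, k (x - y) * (Set.Iio y).indicator (fun s => ψ (x, s)) s * f y :=
          integral_integral_swap hjoint
      _ = _ := by
          refine integral_congr_ae (ae_of_all _ fun s => ?_)
          simp only [hG]
          rw [← integral_const_mul]
          refine integral_congr_ae (ae_of_all _ fun y => ?_)
          simp only [Set.indicator, Set.mem_Iio, Set.mem_Ioi]
          split_ifs <;> ring
  have hpt : ∀ x, ‖∫ y, k (x - y) * φ (x, y) * f y‖ₑ ≤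
      ENNReal.ofReal B * ∫⁻ s in I, ‖G x s‖ₑ := by
    intro x
    rw [hrep x, ← lintegral_const_mul'' _ (hGm' x).restrict.enorm]
    refine (enorm_integral_le_lintegral_enorm _).trans (lintegral_mono fun s => ?_)
    rw [enorm_mul]
    refine mul_le_mul_left ?_ _
    rw [← ofReal_norm]
    exact ENNReal.ofReal_le_ofReal (hB _)
  have hGs : ∀ s, ∫⁻ x, ‖G x s‖ₑ ^ 2 ≤ (M * eLpNorm f 2 volume) ^ 2 := by
    intro s
    rw [← eLpNorm_two_sq]
    refine pow_le_pow_left' ((hM _ (hf.indicator measurableSet_Ioi)).trans ?_) 2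
    exact mul_le_mul_right (eLpNorm_indicator_le _) _
  refine (ENNReal.pow_right_strictMono two_ne_zero).le_iff_le.1 ?_
  rw [eLpNorm_two_sq]
  calc _ ≤ ∫⁻ x, ENNReal.ofReal B ^ 2 * (volume I * ∫⁻ s in I, ‖G x s‖ₑ ^ 2) := by
        refine lintegral_mono fun x => (pow_le_pow_left' (hpt x) 2).trans ?_
        rw [mul_pow]
        exact mul_le_mul_right (sq_setLIntegral_le (hGm' x) I) _
    _ = ENNReal.ofReal B ^ 2 * (volume I * ∫⁻ x, ∫⁻ s in I, ‖G x s‖ₑ ^ 2) := by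
        rw [lintegral_const_mul' _ _ (by simp),
          lintegral_const_mul' _ _ (by rw [hIvol]; exact ENNReal.ofReal_ne_top)]
    _ = ENNReal.ofReal B ^ 2 * (volume I * ∫⁻ s in I, ∫⁻ x, ‖G x s‖ₑ ^ 2) := by
        rw [lintegral_lintegral_swap]
        exact (hGm.measurable.enorm.pow_const 2).aemeasurable
    _ ≤ ENNReal.ofReal B ^ 2 * (volume I * ∫⁻ _ in I, (M * eLpNorm f 2 volume) ^ 2) := by
        gcongr with s
        exact hGs s
    _ = _ := by
        rw [setLIntegral_const, hIvol, ENNReal.ofReal_mul hB0]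
        ring

/-- A compactly supported smooth function is the integral of its derivative in the second
variable. -/
theorem exists_amplitude_representation {φ : ℝ × ℝ → ℂ} (hφ : ContDiff ℝ ∞ φ)
    (hc : HasCompactSupport φ) :
    ∃ (ψ : ℝ × ℝ → ℂ) (B R : ℝ), Continuous ψ ∧ 0 ≤ R ∧ (∀ p, ‖ψ p‖ ≤ B) ∧
      ∀ x y, φ (x, y) =
        ∫ s in Set.Icc (-R) R, (Set.Iio y).indicator (fun s => ψ (x, s)) s := by
  have hψc : Continuous fun p => fderiv ℝ φ p (0, 1) :=
    (hφ.continuous_fderiv (by simp)).clm_apply continuous_const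
  obtain ⟨B, hB⟩ := Continuous.bounded_above_of_compact_support
    hψc (hc.fderiv_apply ℝ (0, 1))
  obtain ⟨R, hR⟩ := hc.isCompact.isBounded.subset_closedBall 0
  have hin : ∀ x s : ℝ, (x, s) ∈ tsupport φ → s ∈ Set.Icc (-|R|) |R| := by
    intro x s h
    have h1 := hR h
    rw [mem_closedBall_zero_iff, Prod.norm_def] at h1
    exact abs_le.1 (((le_max_right _ _).trans h1).trans (le_abs_self R))
  refine ⟨fun p => fderiv ℝ φ p (0, 1), B, |R|, hψc, abs_nonneg _, hB, fun x y => ?_⟩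
  have hder : ∀ s, HasDerivAt (fun s => φ (x, s)) (fderiv ℝ φ (x, s) (0, 1)) s := fun s =>
    ((hφ.differentiable (by simp)) (x, s)).hasFDerivAt.comp_hasDerivAt s
      ((hasDerivAt_const s x).prodMk (hasDerivAt_id s))
  have hcs : HasCompactSupport fun s => φ (x, s) := by
    refine HasCompactSupport.intro (isCompact_Icc (a := -|R|) (b := |R|)) fun s hs => ?_
    by_contra h
    exact hs (hin x s (subset_tsupport φ h))
  have hsm : ContDiff ℝ 1 fun s => φ (x, s) :=
    (hφ.of_le (by simp)).comp (contDiff_const.prodMk contDiff_id)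
  have e := hcs.integral_Iic_deriv_eq hsm y
  simp only [(hder _).deriv] at e
  rw [setIntegral_eq_integral_of_forall_compl_eq_zero, integral_indicator measurableSet_Iio,
    ← integral_Iic_eq_integral_Iio, e]
  intro s hs
  refine Set.indicator_apply_eq_zero.2 fun _ => ?_
  have : fderiv ℝ φ (x, s) = 0 := by
    by_contra h
    exact hs (hin x s (support_fderiv_subset ℝ h))
  simp only [this, zero_apply]

/-! ### The operators `U` and `W_λ` -/

theorem transInvKernel_eq (n : ℕ) (z : ℂ) (x y : ℝ) :
    transInvKernel n z x y = oscKernel n 1 1 z (x - y) := by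
  rw [transInvKernel, oscKernel, one_mul]

theorem transInvOp_eq (n : ℕ) (z : ℂ) (f : ℝ → ℂ) :
    transInvOp n z f = fun x => ∫ y, oscKernel n 1 1 z (x - y) * f y := by
  ext x
  simp only [transInvOp, transInvKernel_eq]

theorem cutoffKernel_eq (n : ℕ) (z : ℂ) (φ : ℝ × ℝ → ℂ) (l x y : ℝ) :
    cutoffKernel n z φ l x y = oscKernel n l (|l| ^ (-(1 / (n : ℝ)))) z (x - y) * φ (x, y) := rfl

theorem abs_mul_scale_pow {n : ℕ} (hn : 2 ≤ n) {l : ℝ} (hl : l ≠ 0) :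
    |l| * (|l| ^ (-(1 / (n : ℝ)))) ^ n = 1 := by
  have hl' : 0 < |l| := abs_pos.2 hl
  have hn0 : (n : ℝ) ≠ 0 := by exact_mod_cast (by lia : n ≠ 0)
  rw [← Real.rpow_natCast (|l| ^ _), ← Real.rpow_mul hl'.le, neg_mul, one_div,
    inv_mul_cancel₀ hn0, Real.rpow_neg_one, mul_inv_cancel₀ hl'.ne']

/-- The linear bounds in `|Im z|` obtained below imply the quadratic ones. -/
theorem ofReal_mul_one_add_le_sq {c C : ℝ} (hC : 0 ≤ C) (hc : c ≤ C) (τ : ℝ) :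
    ENNReal.ofReal (c * (1 + |τ|)) ≤ ENNReal.ofReal (C * (1 + |τ|) ^ 2) := by
  refine ENNReal.ofReal_le_ofReal ?_
  have h : 1 + |τ| ≤ (1 + |τ|) ^ 2 := le_self_pow₀ (by linarith [abs_nonneg τ]) two_ne_zero
  have h0 : 0 ≤ 1 + |τ| := by positivity
  exact (mul_le_mul_of_nonneg_right hc h0).trans (mul_le_mul_of_nonneg_left h hC)

theorem memLp_of_eLpNorm_le_ofReal_mul {g : ℝ → ℂ} {p A : ℝ≥0∞} {c : ℝ}
    (hg : AEStronglyMeasurable g) (h : eLpNorm g p volume ≤ ENNReal.ofReal c * A) (hA : A ≠ ⊤) :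
    MemLp g p :=
  ⟨hg, h.trans_lt (ENNReal.mul_lt_top ENNReal.ofReal_lt_top hA.lt_top)⟩

theorem mainTheorem7 (n : ℕ) (hn : 2 ≤ n) :
    (∃ C : ℝ, 0 < C ∧ ∀ z : ℂ, z.re = -1 →
      (∀ f : ℝ → ℂ, MemLp f 2 volume →
        (∀ x : ℝ, Integrable (fun y => transInvKernel n z x y * f y) volume) ∧
        MemLp (transInvOp n z f) 2 volume ∧
        eLpNorm (transInvOp n z f) 2 volume
          ≤ ENNReal.ofReal (C * (1 + |z.im|) ^ 2) * eLpNorm f 2 volume) ∧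
      (∀ f : ℝ → ℂ, MemH1 f →
        (∀ x : ℝ, Integrable (fun y => transInvKernel n z x y * f y) volume) ∧
        MemLp (transInvOp n z f) 1 volume ∧
        eLpNorm (transInvOp n z f) 1 volume
          ≤ ENNReal.ofReal (C * (1 + |z.im|) ^ 2) * h1Norm f)) ∧
    (∀ φ : ℝ × ℝ → ℂ, ContDiff ℝ ∞ φ → HasCompactSupport φ →
      ∃ C : ℝ, 0 < C ∧ ∀ l : ℝ, l ≠ 0 → ∀ z : ℂ, z.re = -1 →
        ∀ f : ℝ → ℂ, MemLp f 2 volume →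
          (∀ x : ℝ, Integrable (fun y => cutoffKernel n z φ l x y * f y) volume) ∧
          MemLp (cutoffOp n z φ l f) 2 volume ∧
          eLpNorm (cutoffOp n z φ l f) 2 volume
            ≤ ENNReal.ofReal (C * (1 + |z.im|) ^ 2) * eLpNorm f 2 volume) := by
  refine ⟨⟨atomConst n, by rw [atomConst]; positivity, fun z hz => ?_⟩, fun φ hφ hφc => ?_⟩
  · have hC : 14 ≤ atomConst n := by
      rw [atomConst]
      have : (0 : ℝ) ≤ n * 8 ^ n + 96 * 2 ^ n := by positivity
      linarith
    have hkc := continuous_oscKernel (n := n) (l := 1) (z := z) one_pos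
    simp only [transInvKernel_eq, transInvOp_eq]
    refine ⟨fun f hf => ?_, fun f hf => ?_⟩
    · have hbound := (eLpNorm_oscKernel_conv_le hn one_ne_zero one_pos (by simp) hz hf).trans
        (mul_le_mul_left (ofReal_mul_one_add_le_sq (by linarith) hC z.im) _)
      exact ⟨integrable_conv_of_memLp_two (memLp_oscKernel one_pos hz) hf,
        memLp_of_eLpNorm_le_ofReal_mul (aestronglyMeasurable_conv hkc.measurable
          hf.aestronglyMeasurable) hbound hf.eLpNorm_ne_top, hbound⟩
    · have hfi := memLp_one_iff_integrable.1 hf.1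
      have hbound := (eLpNorm_one_conv_le_h1Norm hn hz hfi).trans
        (mul_le_mul_left (ofReal_mul_one_add_le_sq (by linarith) le_rfl z.im) _)
      refine ⟨integrable_conv_of_bounded hkc.measurable (c := 1) (fun t => ?_) hfi,
        memLp_of_eLpNorm_le_ofReal_mul (aestronglyMeasurable_conv hkc.measurable
          hfi.aestronglyMeasurable) hbound (h1Norm_ne_top hf), hbound⟩
      rw [norm_oscKernel one_pos hz]
      exact inv_le_one_of_one_le₀ (by linarith [abs_nonneg t])
  · obtain ⟨ψ, B, R, hψ, hR, hB, hrep⟩ := exists_amplitude_representation hφ hφc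
    have hB0 : 0 ≤ B := (norm_nonneg _).trans (hB 0)
    obtain ⟨D, hD⟩ := hφ.continuous.bounded_above_of_compact_support hφc
    refine ⟨B * (2 * R) * 14 + 1, by positivity, fun l hl z hz f hf => ?_⟩
    set δ : ℝ := |l| ^ (-(1 / (n : ℝ))) with hδdef
    have hδ : 0 < δ := Real.rpow_pos_of_pos (abs_pos.2 hl) _
    have hkm := (continuous_oscKernel (n := n) (l := l) (z := z) hδ).measurable
    have hk2 := memLp_oscKernel (n := n) (l := l) hδ hz
    have hop : cutoffOp n z φ l f =
        fun x => ∫ y, oscKernel n l δ z (x - y) * φ (x, y) * f y := rfl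
    have hbound := eLpNorm_conv_amplitude_le hkm hk2
      (fun g hg => eLpNorm_oscKernel_conv_le hn hl hδ (abs_mul_scale_pow hn hl) hz hg)
      hψ hB hrep hf
    rw [← ENNReal.ofReal_mul (by positivity), ← mul_assoc, ← hop] at hbound
    replace hbound := hbound.trans (mul_le_mul_left
      (ofReal_mul_one_add_le_sq (C := B * (2 * R) * 14 + 1) (by positivity) (by linarith) z.im) _)
    refine ⟨fun x => ?_, memLp_of_eLpNorm_le_ofReal_mul ?_ hbound hf.eLpNorm_ne_top, hbound⟩
    · have hφx : Continuous fun y => φ (x, y) := hφ.continuous.comp (by fun_prop)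
      refine ((integrable_conv_of_memLp_two hk2 hf x).bdd_mul hφx.aestronglyMeasurable
        (ae_of_all _ fun y => hD (x, y))).congr (ae_of_all _ fun y => ?_)
      simp only [cutoffKernel_eq]
      ring
    · rw [hop]
      refine AEStronglyMeasurable.integral_prod_right'
        (f := fun p : ℝ × ℝ => oscKernel n l δ z (p.1 - p.2) * φ (p.1, p.2) * f p.2)
        (μ := volume) (ν := volume) ?_
      exact ((hkm.comp (measurable_fst.sub measurable_snd)).aestronglyMeasurable.mul
        hφ.continuous.aestronglyMeasurable).mul hf.aestronglyMeasurable.comp_snd
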